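/- **Setting.** Let $\mathcal S$ be the space of locally finite subsets (configurations) of $\mathbb R^d$ with the topology of convergence on compact sets (the coarsest one for which $\Upsilon\mapsto\sum_{x\in\Upsilon}f(x)$ is continuous for all continuous compactly supported $f$) and its Borel $\sigma$-algebra. Let $\mathcal D=\{x:|x-c|<R\}$, $R>0$, be an open ball, and let $\mathcal S_{\mathrm{out}}$ be the subspace of configurations contained in $\mathcal D^c$. For a random configuration $Z$ put $Z_{\mathrm{in}}=Z\cap\mathcal D$ and $Z_{\mathrm{out}}=Z\setminus\mathcal D$. Let $(\Xi,\mathbb P)$ be a probability space and $X,X^n:\Xi\to\mathcal S$ random configurations such that almost surely $X^n\to X$, and such that the first intensity measure of $X$ is absolutely continuous with respect to Lebesgue measure. Let $\underline\zeta$ and $\underline\zeta^n$ be the random vectors in $\bigcup_{m\ge0}\mathcal D^m$ formed by the points of $X_{\mathrm{in}}$ and of $X^n_{\mathrm{in}}$, taken in uniform random order (given $X$, respectively $X^n$, all orders are equally likely). Assume that there is a measurable $N:\mathcal S_{\mathrm{out}}\to\{0,1,2,\dots\}$ with $|X_{\mathrm{in}}|=N(X_{\mathrm{out}})$ almost surely.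 Let $\rho(\omega,\cdot)$, $\omega\in\mathcal S_{\mathrm{out}}$, be a regular conditional distribution of $\underline\zeta$ given $X_{\mathrm{out}}$. Write $\Omega^m=\{|X_{\mathrm{in}}|=m\}$ and $\Omega^m_n=\{|X^n_{\mathrm{in}}|=m\}$. Let $\mathfrak A^m$ be the collection of finite non-empty unions of open Euclidean balls contained in $\mathcal D^m$ with rational centres and positive rational radii. Let $\mathcal B$ be the collection of finite non-empty unions of sets of the form $$\{\Upsilon\in\mathcal S_{\mathrm{out}}:|\Upsilon\cap B|=n,\ |\Upsilon\cap B_i|=1\text{ for }1\le i\le n\},$$ where $n\ge0$, $B\subset\mathcal D^c$ is a closed annulus with centre $c$ and rational inradius and outradius (positive, the inradius the smaller one), and $B_1,\dots,B_n$ are pairwise disjoint open balls with positive rational radii and with centres having rational coordinates, such that $B_i\cap\mathcal D^c\subset B$ for all $i$. **Theorem.** Let $m\ge0$ be such that $\mathbb P(\Omega^m)>0$. Suppose: (a) $\nu$ is a map from $\Omega^m$ to the set $\mathcal M(\mathcal D^m)$ of Borel probability measures on $\mathcal D^m$ such that for each Borel set $A\subset\mathcal D^m$ the function $\nu(\cdot,A)$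 on $\Omega^m$ is measurable with respect to (the restriction to $\Omega^m$ of) $X_{\mathrm{out}}$. (b) For each $j$ there are an event $\Omega(j)$, a sequence of indices $(n_k)_k$ (which may depend on $j$) with $n_k\to\infty$, and events $\Omega_{n_k}(j)$, such that: (i) each $\Omega(j)$ is measurable with respect to $X_{\mathrm{out}}$, $\Omega(j)\subset\Omega(j+1)\subset\Omega^m$ for all $j$, and $\mathbb P(\Omega^m\setminus\Omega(j))\to0$ as $j\to\infty$; (ii) $\Omega_{n_k}(j)$ is measurable with respect to $X^{n_k}_{\mathrm{out}}$, and $\Omega_{n_k}(j)\subset\Omega^m_{n_k}$; (iii) $\Omega(j)\subset\varliminf_{k\to\infty}\Omega_{n_k}(j)$; (iv) for each $j$ there are constants $k_1(j),k_2(j)>0$ such that for all $A\in\mathfrak A^m$ and $B\in\mathcal B$ there are real numbers $\vartheta(k;j)=\vartheta_{A,B}(k;j)$ with $\lim_{k\to\infty}\vartheta(k;j)=0$ and, for all $k$, $$k_1(j)\,p_k\le\int_{\{X^{n_k}_{\mathrm{out}}\in B\}\cap\Omega_{n_k}(j)\cap\Omega^m}\nu(\xi,A)\,d\mathbb P(\xi)+\vartheta(k;j)\le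 k_2(j)\,p_k,$$ where $p_k=\mathbb P\big[\{\underline\zeta^{n_k}\in A\}\cap\{X^{n_k}_{\mathrm{out}}\in B\}\cap\Omega_{n_k}(j)\big]$. Then $\nu$ induces a map $\widetilde\nu:\mathcal S_{\mathrm{out}}\to\mathcal M(\mathcal D^m)$, that is, one with $\widetilde\nu(X_{\mathrm{out}}(\xi),\cdot)=\nu(\xi,\cdot)$ for all $\xi\in\Omega^m$, and there are functions $\mathfrak m,\mathfrak M:\mathcal S_{\mathrm{out}}\to(0,\infty)$ such that, almost surely on $\Omega^m$, with $\omega=X_{\mathrm{out}}(\xi)$, $$\mathfrak m(\omega)\,\widetilde\nu(\omega,A)\le\rho(\omega,A)\le\mathfrak M(\omega)\,\widetilde\nu(\omega,A)\qquad\text{for all Borel sets }A\subset\mathcal D^m.$$ -/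

import Mathlib

open MeasureTheory ProbabilityTheory Filter Topology Set
open scoped ENNReal NNReal CompactlySupported

noncomputable section

/-- Locally finite (simple) point configurations on `E`: subsets of `E` meeting every bounded set
in finitely many points. -/
structure Config (E : Type*) [PseudoMetricSpace E] where
  points : Set E
  locallyFinite : ∀ K : Set E, Bornology.IsBounded K → (points ∩ K).Finite

/-- The topology of convergence on compact sets (the vague topology): the coarsest topology for
which `Υ ↦ ∑_{x ∈ Υ} f x` is continuous for every continuous compactly supported `f`. -/
instance Config.instTopologicalSpace (E : Type*) [PseudoMetricSpace E] :
    TopologicalSpace (Config E) :=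
  ⨅ f : C_c(E, ℝ), TopologicalSpace.induced (fun Υ : Config E => ∑ᶠ x ∈ Υ.points, f x)
    inferInstance

instance Config.instMeasurableSpace (E : Type*) [PseudoMetricSpace E] :
    MeasurableSpace (Config E) := borel (Config E)

instance Config.instBorelSpace (E : Type*) [PseudoMetricSpace E] : BorelSpace (Config E) := ⟨rfl⟩

/-- The space of locally finite configurations on `Dᶜ`, with the subspace topology and its Borel
`σ`-algebra. -/
abbrev OutConfig {E : Type*} [PseudoMetricSpace E] (D : Set E) : Type _ :=
  {Υ : Config E // Υ.points ⊆ Dᶜ}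

/-- The part of a configuration outside `D`. -/
def Config.out {E : Type*} [PseudoMetricSpace E] (D : Set E) (Υ : Config E) : OutConfig D :=
  ⟨⟨Υ.points \ D, fun K hK => (Υ.locallyFinite K hK).subset (fun _ hx => ⟨hx.1.1, hx.2⟩)⟩,
    fun _ hx => hx.2⟩

/-- The space `⋃ₘ Dᵐ` (disjoint union) of vectors of variable length with entries in `D`. -/
abbrev VarVec {E : Type*} (D : Set E) : Type _ := Σ m : ℕ, (Fin m → D)

/-- The vectors listing the points of `Υ` in `D`, each exactly once. -/
def orderings {E : Type*} [PseudoMetricSpace E] (D : Set E) (Υ : Config E) : Set (VarVec D) :=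
  {v | Function.Injective v.2 ∧ range (fun i => (v.2 i : E)) = Υ.points ∩ D}

/-- `ζ` is the random vector of the points of `X` in `D`, taken in uniform random order: it lists
the points of `X` in `D`, and given `X` its law is the uniform distribution on the (finite) set of
orderings of these points. -/
structure IsUniformOrdering {Ξ E : Type*} [MeasurableSpace Ξ] [PseudoMetricSpace E]
    [MeasurableSpace E] (P : Measure Ξ) (D : Set E) (X : Ξ → Config E) (ζ : Ξ → VarVec D) :
    Prop where
  measurable : Measurable ζ
  mem : ∀ᵐ ξ ∂P, ζ ξ ∈ orderings D (X ξ)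
  law : ∀ (C : Set (Config E)) (A : Set (VarVec D)), MeasurableSet C → MeasurableSet A →
    P (X ⁻¹' C ∩ ζ ⁻¹' A) = ∫⁻ ξ in X ⁻¹' C, uniformOn (orderings D (X ξ)) A ∂P

/-- `γ` is a regular conditional distribution of `Z` given `Y`. -/
structure IsRegularCondDistrib {Ξ T V : Type*} [MeasurableSpace Ξ] [MeasurableSpace T]
    [MeasurableSpace V] (P : Measure Ξ) (Y : Ξ → T) (Z : Ξ → V) (γ : Kernel T V) : Prop where
  isMarkov : IsMarkovKernel γ
  disintegration : ∀ (B : Set T) (A : Set V), MeasurableSet B → MeasurableSet A →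
    P (Y ⁻¹' B ∩ Z ⁻¹' A) = ∫⁻ t in B, γ t A ∂(P.map Y)

/-- The first intensity of a point process: the expected number of points in `K`. -/
def firstIntensity {Ξ E : Type*} [MeasurableSpace Ξ] [PseudoMetricSpace E] (P : Measure Ξ)
    (X : Ξ → Config E) (K : Set E) : ℝ≥0∞ :=
  ∫⁻ ξ, (((X ξ).points ∩ K).encard : ℝ≥0∞) ∂P

/-- The event that `X` has exactly `m` points in `D`. -/
def countEvent {Ξ E : Type*} [PseudoMetricSpace E] (D : Set E) (X : Ξ → Config E) (m : ℕ) :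
    Set Ξ :=
  {ξ | ((X ξ).points ∩ D).encard = m}

/-- A point of `ℝᵈ` with rational coordinates. -/
def IsRationalPoint {d : ℕ} (x : EuclideanSpace ℝ (Fin d)) : Prop :=
  ∀ i, ∃ q : ℚ, x i = q

/-- The Euclidean ball in `(ℝᵈ)ᵐ = ℝᵈᵐ`. -/
def vecBall {d m : ℕ} (q : Fin m → EuclideanSpace ℝ (Fin d)) (r : ℝ) :
    Set (Fin m → EuclideanSpace ℝ (Fin d)) :=
  {x | ∑ i, ‖x i - q i‖ ^ 2 < r ^ 2}

/-- The open balls contained in `Dᵐ` with rational centre and rational (positive) radius, as subsets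
of `Dᵐ`. -/
def inBasis {d : ℕ} (D : Set (EuclideanSpace ℝ (Fin d))) (m : ℕ) : Set (Set (Fin m → D)) :=
  {A | ∃ (q : Fin m → EuclideanSpace ℝ (Fin d)) (r : ℚ), (∀ i, IsRationalPoint (q i)) ∧ 0 < r ∧
    (∀ x ∈ vecBall q r, ∀ i, x i ∈ D) ∧
    A = {x | (fun i => (x i : EuclideanSpace ℝ (Fin d))) ∈ vecBall q r}}

/-- The closed annulus with centre `c`, inradius `r` and outradius `s`. -/
def closedAnnulus {E : Type*} [PseudoMetricSpace E] (c : E) (r s : ℝ) : Set E :=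
  {x | r ≤ dist x c ∧ dist x c ≤ s}

/-- The sets `{Υ : |Υ ∩ B| = n and |Υ ∩ Bᵢ| = 1 for all i}`, where `B ⊆ Dᶜ` is a closed annulus
with centre `c` and rational radii, and `B₁, …, Bₙ` are disjoint open balls with rational radii and
rational centres such that `Bᵢ ∩ Dᶜ ⊆ B`. -/
def outBasis {d : ℕ} (D : Set (EuclideanSpace ℝ (Fin d))) (c : EuclideanSpace ℝ (Fin d)) :
    Set (Set (OutConfig D)) :=
  {F | ∃ (n : ℕ) (r s : ℚ) (q : Fin n → EuclideanSpace ℝ (Fin d)) (t : Fin n → ℚ),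
    0 < r ∧ r < s ∧ closedAnnulus c (r : ℝ) s ⊆ Dᶜ ∧
    (∀ i, IsRationalPoint (q i) ∧ 0 < t i) ∧
    (Pairwise fun i j => Disjoint (Metric.ball (q i) (t i)) (Metric.ball (q j) (t j))) ∧
    (∀ i, Metric.ball (q i) (t i) ∩ Dᶜ ⊆ closedAnnulus c (r : ℝ) s) ∧
    F = {Υ | (Υ.1.points ∩ closedAnnulus c (r : ℝ) s).encard = n ∧
      ∀ i, (Υ.1.points ∩ Metric.ball (q i) (t i)).encard = 1}}

/-- The unions of finitely many (at least one) members of `𝒞`. -/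
def finiteUnions {α : Type*} (𝒞 : Set (Set α)) : Set (Set α) :=
  {A | ∃ F : Set (Set α), F.Finite ∧ F.Nonempty ∧ F ⊆ 𝒞 ∧ A = ⋃₀ F}

/-- The sequence of events `Ω' j` exhausts the event `Ω`. -/
def Exhausts {Ξ : Type*} [MeasurableSpace Ξ] (P : Measure Ξ) (Ω' : ℕ → Set Ξ) (Ω : Set Ξ) : Prop :=
  (∀ j, Ω' j ⊆ Ω' (j + 1) ∧ Ω' (j + 1) ⊆ Ω) ∧ Ω' 0 ⊆ Ω ∧
    Tendsto (fun j => P (Ω \ Ω' j)) atTop (𝓝 0)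

/-- Measurability of a real function on the event `Ω` with respect to `Y`, that is, with respect to
the `σ`-algebra on `Ω` generated by the restriction of `Y` to `Ω`. -/
def MeasurableOnWrt {Ξ T : Type*} [MeasurableSpace T] (Ω : Set Ξ) (Y : Ξ → T) (g : Ξ → ℝ) : Prop :=
  Measurable[MeasurableSpace.comap (fun ξ : Ω => Y ξ) inferInstance] fun ξ : Ω => g ξ

/-- An event in the `σ`-algebra generated by `Y`. -/
def EventWrt {Ξ T : Type*} [MeasurableSpace T] (Y : Ξ → T) (Ω : Set Ξ) : Prop :=
  MeasurableSet[MeasurableSpace.comap Y inferInstance] Ω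

end

/-! The heart is a passage to the limit on one exhausting event Ω(j) = {X_out ∈ V}. For A in 𝔄^m and
every Borel U ⊆ V it yields k₁ P(X_out ∈ U, ζ ∈ A) ≤ ∫_{X_out ∈ U} ν(A) dP ≤ k₂ P(X_out ∈ U, ζ ∈
closure A) (`comparison_limit`). As U is arbitrary, disintegration turns this into k₁ ρ(A) ≤ ν(A) ≤
k₂ ρ(closure A), almost surely on Ω(j) (`IsRegularCondDistrib.ae_bounds`), for all of the countably
many A at once.

The limit rests on three facts. Since the intensity is absolutely continuous, X almost surely has no
point on any of countably many spheres (`ae_isGeneric`); hence membership of X_out in a set of 𝓑 is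
unchanged under small perturbations of X, and eventually agrees for Xⁿ and X. Secondly, every event
{X_out ∈ U} is approximated in probability by events from finite unions of the basis
(`basisApprox_of_measurableSet`). Thirdly, given the number of points in D, the law of the uniform
ordering is lower semicontinuous on open sets, so Fatou's lemma gives a portmanteau inequality
(`IsUniformOrdering.measure_le_liminf`).

The joint law of the inside points may charge the boundary of A, whence the closure. It does no
harm: an open set is an increasing limit of finite unions of balls whose closures it contains, and
outer regularity passes from open to Borel sets (`measure_bounds_of_finiteUnions`). Finally the
constants are chosen according to the first j whose event contains the configuration. -/

/-! ### Point counts and the topology of convergence on compact sets. -/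

theorem measurable_enat_of_Iic {α : Type*} [MeasurableSpace α] {f : α → ℕ∞}
    (hf : ∀ n, MeasurableSet {a | f a ≤ n}) : Measurable f := by
  refine measurable_to_countable' fun n => ?_
  have : f ⁻¹' {n} = {a | f a ≤ n} \ ⋃ k : {k : ℕ∞ // k < n}, {a | f a ≤ k} := by
    ext a
    simp only [mem_preimage, mem_singleton_iff, Set.mem_sdiff, Set.mem_ofPred_eq, mem_iUnion,
      not_exists, not_le, Subtype.forall]
    refine ⟨fun h => ⟨h.le, fun k hk => h ▸ hk⟩, fun h => h.1.antisymm ?_⟩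
    by_contra hlt
    exact lt_irrefl _ (h.2 _ (not_le.1 hlt))
  rw [this]
  exact (hf n).diff (MeasurableSet.iUnion fun k => hf k)

theorem measurable_enat_of_Ici {α : Type*} [MeasurableSpace α] {f : α → ℕ∞}
    (hf : ∀ n, MeasurableSet {a | n ≤ f a}) : Measurable f := by
  refine measurable_to_countable' fun n => ?_
  have : f ⁻¹' {n} = {a | n ≤ f a} \ ⋃ k : {k : ℕ∞ // n < k}, {a | k ≤ f a} := by
    ext a
    simp only [mem_preimage, mem_singleton_iff, Set.mem_sdiff, Set.mem_ofPred_eq, mem_iUnion,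
      not_exists, not_le, Subtype.forall]
    refine ⟨fun h => ⟨h.ge, fun k hk => h ▸ hk⟩, fun h => le_antisymm ?_ h.1⟩
    by_contra hlt
    exact lt_irrefl _ (h.2 _ (not_le.1 hlt))
  rw [this]
  exact (hf n).diff (MeasurableSet.iUnion fun k => hf k)

namespace Config

section Topology

variable {E : Type*} [MetricSpace E]

theorem continuous_finsum (f : C_c(E, ℝ)) :
    Continuous fun Υ : Config E => ∑ᶠ x ∈ Υ.points, f x :=
  continuous_iInf_dom (i := f) continuous_induced_dom

theorem nhds_eq (Υ : Config E) :
    𝓝 Υ = ⨅ f : C_c(E, ℝ), comap (fun Υ : Config E => ∑ᶠ x ∈ Υ.points, f x)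
      (𝓝 (∑ᶠ x ∈ Υ.points, f x)) := by
  rw [nhds_iInf]
  simp only [nhds_induced]

theorem finsum_eq_sum {ι : Type*} [Fintype ι] (Υ : Config E) (f : E → ℝ) {x : ι → E}
    (hx : Function.Injective x) (hsub : range x ⊆ Υ.points)
    (hcov : ∀ y ∈ Υ.points, f y ≠ 0 → y ∈ range x) :
    ∑ᶠ y ∈ Υ.points, f y = ∑ i, f (x i) := by
  rw [finsum_mem_inter_support_eq f Υ.points (range x), finsum_mem_range hx,
    finsum_eq_sum_of_fintype]
  ext y
  exact ⟨fun h => ⟨hcov y h.1 h.2, h.2⟩, fun h => ⟨hsub h.1, h.2⟩⟩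

theorem finsum_eq_finset_sum (Υ : Config E) (f : E → ℝ) (s : Finset E)
    (hsub : (s : Set E) ⊆ Υ.points) (hcov : ∀ y ∈ Υ.points, f y ≠ 0 → y ∈ s) :
    ∑ᶠ y ∈ Υ.points, f y = ∑ y ∈ s, f y := by
  apply finsum_mem_eq_sum_of_inter_support_eq
  ext y
  exact ⟨fun h => ⟨hcov y h.1 h.2, h.2⟩, fun h => ⟨hsub h.1, h.2⟩⟩

theorem finite_inter_tsupport (Υ : Config E) (f : C_c(E, ℝ)) :
    (Υ.points ∩ tsupport f).Finite :=
  Υ.locallyFinite _ f.hasCompactSupport.isCompact.isBounded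

theorem finsum_eq_sum_tsupport (Υ : Config E) (f : C_c(E, ℝ)) :
    ∑ᶠ y ∈ Υ.points, f y = ∑ y ∈ (Υ.finite_inter_tsupport f).toFinset, f y := by
  apply Υ.finsum_eq_finset_sum
  · intro y hy
    simp only [Finite.coe_toFinset] at hy
    exact hy.1
  · intro y hy h
    simp only [Finite.mem_toFinset]
    exact ⟨hy, subset_tsupport _ h⟩

theorem exists_bump [ProperSpace E] {K V : Set E} (hK : IsCompact K) (hV : IsOpen V) (hKV : K ⊆ V) :
    ∃ f : C_c(E, ℝ), EqOn f 1 K ∧ tsupport f ⊆ V ∧ ∀ x, f x ∈ Icc (0 : ℝ) 1 := by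
  obtain ⟨f, h1, h2, h3, h4⟩ := exists_continuousMap_one_of_isCompact_subset_isOpen hK hV hKV
  exact ⟨⟨f, h2⟩, h1, h3, h4⟩

theorem encard_le_finsum (Υ : Config E) {K : Set E} {f : C_c(E, ℝ)} (h1 : EqOn f 1 K)
    (h0 : ∀ x, f x ∈ Icc (0 : ℝ) 1) (s : Finset E) (hs : (s : Set E) ⊆ Υ.points ∩ K) :
    (s.card : ℝ) ≤ ∑ᶠ y ∈ Υ.points, f y := by
  rw [finsum_eq_sum_tsupport]
  calc (s.card : ℝ) = ∑ y ∈ s, f y := by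
        rw [Finset.sum_congr rfl (g := fun _ => (1 : ℝ)) fun y hy => h1 (hs hy).2]
        simp
    _ ≤ _ := by
        apply Finset.sum_le_sum_of_subset_of_nonneg
        · intro y hy
          simp only [Finite.mem_toFinset]
          refine ⟨(hs hy).1, subset_tsupport _ ?_⟩
          rw [Function.mem_support, h1 (hs hy).2]
          simp
        · exact fun y _ _ => (h0 y).1

theorem finsum_le_encard (Υ : Config E) {V : Set E} {f : C_c(E, ℝ)} (hV : tsupport f ⊆ V)
    (h0 : ∀ x, f x ∈ Icc (0 : ℝ) 1) {n : ℕ} (hn : (Υ.points ∩ V).encard ≤ n) :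
    ∑ᶠ y ∈ Υ.points, f y ≤ n := by
  rw [finsum_eq_sum_tsupport]
  calc _ ≤ ∑ y ∈ (Υ.finite_inter_tsupport f).toFinset, (1 : ℝ) :=
        Finset.sum_le_sum fun y _ => (h0 y).2
    _ ≤ n := by
        simp only [Finset.sum_const, nsmul_eq_mul, mul_one, Nat.cast_le]
        have := (encard_le_encard (inter_subset_inter_right Υ.points hV)).trans hn
        rw [← (Υ.finite_inter_tsupport f).coe_toFinset, encard_coe_eq_coe_finsetCard] at this
        exact_mod_cast this

/-- The bump is 1 on `K` and its support avoids the nearby points of `Υ` outside `K`, so its sum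
over `Υ` is at most the count in `K`. The sum is continuous and counts are integers, so a change of
less than 1 cannot raise the count. -/
theorem eventually_encard_inter_le [ProperSpace E] (Υ : Config E) {K : Set E} (hK : IsCompact K) :
    ∀ᶠ Υ' in 𝓝 Υ, (Υ'.points ∩ K).encard ≤ (Υ.points ∩ K).encard := by
  obtain ⟨B, hB, hKB⟩ : ∃ B : Set E, (IsOpen B ∧ Bornology.IsBounded B) ∧ K ⊆ B := by
    refine ⟨Metric.thickening 1 K, ⟨Metric.isOpen_thickening, hK.isBounded.thickening⟩,
      Metric.self_subset_thickening one_pos K⟩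
  have hfinB := Υ.locallyFinite B hB.2
  have hfin := Υ.locallyFinite K hK.isBounded
  obtain ⟨f, hf1, hfV, hf0⟩ := exists_bump (V := B \ ((Υ.points ∩ B) \ K)) hK
    (hB.1.sdiff (hfinB.sdiff).isClosed) fun x hx => ⟨hKB hx, fun h => h.2 hx⟩
  have hle : ∑ᶠ y ∈ Υ.points, f y ≤ (hfin.toFinset.card : ℝ) := by
    refine (Υ.finsum_le_encard hfV hf0 (n := hfin.toFinset.card) ?_)
    rw [← encard_coe_eq_coe_finsetCard, hfin.coe_toFinset]
    apply encard_le_encard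
    rintro y ⟨hy, hyB, hyK⟩
    refine ⟨hy, ?_⟩
    by_contra h
    exact hyK ⟨⟨hy, hyB⟩, h⟩
  have hev := (continuous_finsum f).continuousAt.eventually_lt
    (continuousAt_const (y := (hfin.toFinset.card : ℝ) + 1)) (by simpa using by linarith)
  filter_upwards [hev] with Υ' h
  have hfin' := Υ'.locallyFinite K hK.isBounded
  have h2 := Υ'.encard_le_finsum hf1 hf0 hfin'.toFinset (by simp)
  have h3 : hfin'.toFinset.card < hfin.toFinset.card + 1 := by exact_mod_cast h2.trans_lt h
  rw [← hfin.coe_toFinset, ← hfin'.coe_toFinset, encard_coe_eq_coe_finsetCard,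
    encard_coe_eq_coe_finsetCard]
  exact_mod_cast Nat.lt_succ_iff.1 h3

theorem eventually_le_encard_inter [ProperSpace E] (Υ : Config E) {V : Set E} (hV : IsOpen V)
    (hb : Bornology.IsBounded V) :
    ∀ᶠ Υ' in 𝓝 Υ, (Υ.points ∩ V).encard ≤ (Υ'.points ∩ V).encard := by
  have hfin := Υ.locallyFinite V hb
  obtain ⟨f, hf1, hfV, hf0⟩ := exists_bump hfin.isCompact hV inter_subset_right
  have hle := Υ.encard_le_finsum hf1 hf0 hfin.toFinset (by simp)
  have hev := (continuousAt_const (y := (hfin.toFinset.card : ℝ) - 1)).eventually_lt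
    (continuous_finsum f).continuousAt (by simpa using by linarith)
  filter_upwards [hev] with Υ' h
  have hfin' := Υ'.locallyFinite V hb
  have h2 := Υ'.finsum_le_encard hfV hf0 (n := hfin'.toFinset.card) (by
    rw [← encard_coe_eq_coe_finsetCard, hfin'.coe_toFinset])
  have h3 : hfin.toFinset.card < hfin'.toFinset.card + 1 := by
    have : (hfin.toFinset.card : ℝ) < hfin'.toFinset.card + 1 := by linarith
    exact_mod_cast this
  rw [← hfin.coe_toFinset, ← hfin'.coe_toFinset, encard_coe_eq_coe_finsetCard,
    encard_coe_eq_coe_finsetCard]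
  exact_mod_cast Nat.lt_succ_iff.1 h3

/-- The count in `K` lies between those in the interior and the closure, which are lower and upper
semicontinuous and agree at `Υ`. -/
theorem eventually_encard_inter_eq [ProperSpace E] (Υ : Config E) {K : Set E}
    (hb : Bornology.IsBounded K)
    (hK : Disjoint Υ.points (frontier K)) :
    ∀ᶠ Υ' in 𝓝 Υ, (Υ'.points ∩ K).encard = (Υ.points ∩ K).encard := by
  filter_upwards [Υ.eventually_encard_inter_le hb.isCompact_closure,
    Υ.eventually_le_encard_inter isOpen_interior (hb.subset interior_subset)] with Υ' h1 h2
  have hmem : ∀ y ∈ Υ.points, y ∈ closure K → y ∈ interior K := by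
    intro y hy hc
    by_contra h
    exact disjoint_left.1 hK hy ⟨hc, h⟩
  apply le_antisymm
  · refine (encard_le_encard (inter_subset_inter_right _ subset_closure)).trans (h1.trans ?_)
    exact encard_le_encard fun y hy => ⟨hy.1, interior_subset (hmem y hy.1 hy.2)⟩
  · refine le_trans ?_ (h2.trans (encard_le_encard (inter_subset_inter_right _ interior_subset)))
    exact encard_le_encard fun y hy => ⟨hy.1, hmem y hy.1 (subset_closure hy.2)⟩

theorem measurable_encard_inter_of_isOpen [ProperSpace E] {V : Set E} (hV : IsOpen V)
    (hb : Bornology.IsBounded V) :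
    Measurable fun Υ : Config E => (Υ.points ∩ V).encard := by
  refine measurable_enat_of_Ici fun n => IsOpen.measurableSet (isOpen_iff_mem_nhds.2 fun Υ hΥ => ?_)
  filter_upwards [Υ.eventually_le_encard_inter hV hb] with Υ' h
  exact le_trans hΥ h

theorem measurable_encard_inter_of_isCompact [ProperSpace E] {K : Set E} (hK : IsCompact K) :
    Measurable fun Υ : Config E => (Υ.points ∩ K).encard := by
  refine measurable_enat_of_Iic fun n => IsOpen.measurableSet (isOpen_iff_mem_nhds.2 fun Υ hΥ => ?_)
  filter_upwards [Υ.eventually_encard_inter_le hK] with Υ' h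
  exact le_trans h hΥ

/-- A configuration which agrees near `Υ` with a small perturbation of a list of points of `Υ`
lies in any prescribed neighbourhood of `Υ`. -/
theorem exists_radius_forall_eventually_mem (c : E) {Υ : Config E} {U : Set (Config E)}
    (hU : U ∈ 𝓝 Υ) :
    ∃ s : ℝ, ∀ (n : ℕ) (x : Fin n → E), Function.Injective x → range x ⊆ Υ.points →
      Υ.points ∩ Metric.ball c s ⊆ range x →
      ∀ᶠ x' in 𝓝 x, ∀ Υ' : Config E, Function.Injective x' → range x' ⊆ Υ'.points →
        Υ'.points ∩ Metric.ball c s ⊆ range x' → Υ' ∈ U := by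
  -- The sets `U` with the required property form a filter, so comparing it with `𝓝 Υ` reduces to
  -- neighbourhoods given by a single test function.
  let L : Filter (Config E) :=
    { sets := {U | ∃ s : ℝ, ∀ (n : ℕ) (x : Fin n → E), Function.Injective x →
        range x ⊆ Υ.points → Υ.points ∩ Metric.ball c s ⊆ range x →
        ∀ᶠ x' in 𝓝 x, ∀ Υ' : Config E, Function.Injective x' → range x' ⊆ Υ'.points →
          Υ'.points ∩ Metric.ball c s ⊆ range x' → Υ' ∈ U}
      univ_sets := ⟨0, fun _ _ _ _ _ => Eventually.of_forall fun _ _ _ _ _ => mem_univ _⟩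
      sets_of_superset := by
        rintro U V ⟨s, hs⟩ hUV
        refine ⟨s, fun n x h1 h2 h3 => ?_⟩
        filter_upwards [hs n x h1 h2 h3] with x' hx' Υ' k1 k2 k3
        exact hUV (hx' Υ' k1 k2 k3)
      inter_sets := by
        rintro U V ⟨s, hs⟩ ⟨t, ht⟩
        have e1 : Metric.ball c s ⊆ Metric.ball c (max s t) :=
          Metric.ball_subset_ball (le_max_left _ _)
        have e2 : Metric.ball c t ⊆ Metric.ball c (max s t) :=
          Metric.ball_subset_ball (le_max_right _ _)
        refine ⟨max s t, fun n x h1 h2 h3 => ?_⟩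
        filter_upwards [hs n x h1 h2 ((inter_subset_inter_right _ e1).trans h3),
          ht n x h1 h2 ((inter_subset_inter_right _ e2).trans h3)] with x' hx' hy' Υ' k1 k2 k3
        exact ⟨hx' Υ' k1 k2 ((inter_subset_inter_right _ e1).trans k3),
          hy' Υ' k1 k2 ((inter_subset_inter_right _ e2).trans k3)⟩ }
  suffices h : L ≤ 𝓝 Υ from h hU
  rw [nhds_eq]
  refine le_iInf fun f => ?_
  rintro W ⟨V, hV, hVW⟩
  obtain ⟨s, hs⟩ := (Metric.isBounded_iff_subset_ball c).1 f.hasCompactSupport.isCompact.isBounded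
  have hcov : ∀ (Υ' : Config E) (n : ℕ) (x' : Fin n → E),
      Υ'.points ∩ Metric.ball c s ⊆ range x' → ∀ y ∈ Υ'.points, f y ≠ 0 → y ∈ range x' :=
    fun Υ' n x' h y hy h0 => h ⟨hy, hs (subset_tsupport _ h0)⟩
  refine ⟨s, fun n x h1 h2 h3 => ?_⟩
  have hcont : ContinuousAt (fun x' : Fin n → E => ∑ i, f (x' i)) x := by
    have := f.continuous
    refine Continuous.continuousAt (continuous_finsetSum _ fun i _ => ?_)
    fun_prop
  rw [Υ.finsum_eq_sum f h1 h2 (hcov Υ n x h3)] at hV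
  filter_upwards [hcont hV] with x' hx' Υ' k1 k2 k3
  apply hVW
  rw [mem_preimage, Υ'.finsum_eq_sum f k1 k2 (hcov Υ' n x' k3)]
  exact hx'

end Topology

end Config

/-! ### Finite lists of points and their perturbations. -/

theorem Set.Finite.exists_injective_range_eq {α : Type*} {S : Set α} (hS : S.Finite) :
    ∃ (n : ℕ) (x : Fin n → α), Function.Injective x ∧ range x = S := by
  obtain ⟨n, x, hx, h⟩ := hS.fin_param
  exact ⟨n, x, hx, h⟩

theorem Function.Injective.encard_range_fin {α : Type*} {n : ℕ} {x : Fin n → α}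
    (hx : Function.Injective x) : (range x).encard = n := by
  rw [← image_univ, hx.encard_image, encard_univ]
  simp

theorem Function.Injective.range_eq_of_subset {α : Type*} {n : ℕ} {x : Fin n → α} {S : Set α}
    (hx : Function.Injective x) (hS : range x ⊆ S) (hn : S.encard ≤ n) : range x = S :=
  (finite_range x).eq_of_subset_of_encard_le hS (hn.trans hx.encard_range_fin.ge)

theorem eventually_injective {E : Type*} [TopologicalSpace E] [T2Space E] {n : ℕ} {x : Fin n → E}
    (hx : Function.Injective x) : ∀ᶠ x' in 𝓝 x, Function.Injective x' := by
  have h : ∀ i j : Fin n, i ≠ j → ∀ᶠ x' in 𝓝 x, x' i ≠ x' j := by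
    intro i j hij
    exact (isOpen_ne_fun (continuous_apply i) (continuous_apply j)).mem_nhds (hx.ne hij)
  have h' : ∀ᶠ x' in 𝓝 x, ∀ i j : Fin n, i ≠ j → x' i ≠ x' j := by
    simp only [eventually_all]
    exact h
  filter_upwards [h'] with x' hx' i j hij
  by_contra hne
  exact hx' i j hne hij

/-! ### Measurability of the restriction to the outside. -/

namespace Config

section Out

variable {E : Type*} [MetricSpace E]

theorem out_inter_eq (D : Set E) (Υ : Config E) (K : Set E) :
    (Υ.out D).1.points ∩ K = Υ.points ∩ (K \ D) := by
  ext y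
  simp only [Config.out, Set.mem_inter_iff, Set.mem_sdiff]
  tauto

/-- At most `n` points in a closed ball, and at least one point in each of `n` smaller balls. -/
def boxSet (c : E) (q : ℕ → E) (a : Σ n : ℕ, ℕ × (Fin n → ℕ × ℚ)) : Set (Config E) :=
  {Υ | (Υ.points ∩ Metric.closedBall c a.2.1).encard ≤ a.1 ∧ ∀ i : Fin a.1,
    1 ≤ (Υ.points ∩ (Metric.closedBall c a.2.1 ∩
      Metric.closedBall (q (a.2.2 i).1) (a.2.2 i).2)).encard}

/-- The sets `boxSet` form a countable network for the topology. One point near each of the `n`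
points of `Υ` gives `n` distinct points, and the bound on the count leaves room for no others. -/
theorem exists_boxSet (c : E) {q : ℕ → E} (hq : DenseRange q) {Υ : Config E} {U : Set (Config E)}
    (hU : U ∈ 𝓝 Υ) : ∃ a, Υ ∈ boxSet c q a ∧ boxSet c q a ⊆ U := by
  obtain ⟨s₀, hs₀⟩ := exists_radius_forall_eventually_mem c hU
  obtain ⟨s, hs⟩ := exists_nat_ge s₀
  have hss : Metric.ball c s₀ ⊆ Metric.closedBall c s :=
    (Metric.ball_subset_ball hs).trans Metric.ball_subset_closedBall
  obtain ⟨n, x, hx, hxr⟩ :=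
    (Υ.locallyFinite (Metric.closedBall c s) Metric.isBounded_closedBall).exists_injective_range_eq
  have hev := (hs₀ n x hx (hxr ▸ inter_subset_left)
    (hxr ▸ inter_subset_inter_right _ hss)).and (eventually_injective hx)
  obtain ⟨δ, hδ, hev⟩ := Metric.eventually_nhds_iff.1 hev
  obtain ⟨t, ht1, ht2⟩ := exists_rat_btwn (show δ / 4 < δ / 2 by linarith)
  have hk : ∀ i, ∃ k, dist (x i) (q k) < δ / 4 := fun i => hq.exists_dist_lt (x i) (by linarith)
  choose k hk using hk
  refine ⟨⟨n, s, fun i => (k i, t)⟩, ⟨?_, fun i => ?_⟩, ?_⟩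
  · rw [← hxr, hx.encard_range_fin]
  · rw [one_le_encard_iff_nonempty]
    have h : x i ∈ range x := mem_range_self i
    rw [hxr] at h
    exact ⟨x i, h.1, h.2, Metric.mem_closedBall.2 ((hk i).trans ht1).le⟩
  · rintro Υ' ⟨h1, h2⟩
    simp only [one_le_encard_iff_nonempty] at h1 h2
    choose x' hx' using h2
    have hd : dist x' x < δ := by
      rw [dist_pi_lt_iff hδ]
      intro i
      have h3 := Metric.mem_closedBall.1 (hx' i).2.2
      have h4 := dist_triangle_right (x' i) (x i) (q (k i))
      have h5 := hk i
      linarith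
    obtain ⟨h3, h4⟩ := hev hd
    have hsub : range x' ⊆ Υ'.points ∩ Metric.closedBall c s := by
      rintro _ ⟨i, rfl⟩
      exact ⟨(hx' i).1, (hx' i).2.1⟩
    refine h3 Υ' h4 (hsub.trans inter_subset_left) ?_
    rw [h4.range_eq_of_subset hsub h1]
    exact inter_subset_inter_right _ hss

/-- Points may cross the boundary of `D`, so continuity cannot be used. An open set is a countable
union of sets `boxSet`, and their preimages are conditions on counts in compact sets, `D` being
open. -/
theorem measurable_out [ProperSpace E] [Nonempty E] {D : Set E} (hD : IsOpen D) :
    Measurable (Config.out D : Config E → OutConfig D) := by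
  suffices h : Measurable fun Υ : Config E => (Υ.out D).1 from h.subtype_mk
  refine measurable_of_isOpen fun U hU => ?_
  let c := Classical.arbitrary E
  let q := TopologicalSpace.denseSeq E
  have hq : DenseRange q := TopologicalSpace.denseRange_denseSeq E
  have hUeq : U = ⋃ a : {a // boxSet c q a ⊆ U}, boxSet c q a := by
    apply Subset.antisymm
    · intro Υ hΥ
      obtain ⟨a, h1, h2⟩ := exists_boxSet c hq (hU.mem_nhds hΥ)
      exact mem_iUnion.2 ⟨⟨a, h2⟩, h1⟩
    · exact iUnion_subset fun a => a.2
  rw [hUeq, preimage_iUnion]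
  refine MeasurableSet.iUnion fun a => ?_
  have : (fun Υ : Config E => (Υ.out D).1) ⁻¹' boxSet c q a =
      {Υ : Config E | (Υ.points ∩ (Metric.closedBall c a.1.2.1 \ D)).encard ≤ a.1.1} ∩
      ⋂ i : Fin a.1.1, {Υ : Config E | 1 ≤ (Υ.points ∩ ((Metric.closedBall c a.1.2.1 ∩
        Metric.closedBall (q (a.1.2.2 i).1) (a.1.2.2 i).2) \ D)).encard} := by
    ext Υ
    simp only [boxSet, mem_preimage, Set.mem_ofPred_eq, out_inter_eq, Set.mem_inter_iff,
      Set.mem_iInter]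
  rw [this]
  refine MeasurableSet.inter ?_ (MeasurableSet.iInter fun i => ?_)
  · exact measurable_encard_inter_of_isCompact ((isCompact_closedBall _ _).diff hD)
      (t := Iic (a.1.1 : ℕ∞)) trivial
  · exact measurable_encard_inter_of_isCompact
      (((isCompact_closedBall _ _).inter_right Metric.isClosed_closedBall).diff hD)
      (t := Ici 1) trivial

end Out

end Config

/-! ### Measurable sets of vectors of variable length. -/

theorem Sigma.measurableSet_iff {ι : Type*} {α : ι → Type*} [∀ i, MeasurableSpace (α i)]
    {s : Set (Σ i, α i)} : MeasurableSet s ↔ ∀ i, MeasurableSet (Sigma.mk i ⁻¹' s) := by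
  simp only [MeasurableSpace.measurableSet_iInf]
  rfl

instance Sigma.instMeasurableSingletonClass {ι : Type*} {α : ι → Type*}
    [∀ i, MeasurableSpace (α i)] [∀ i, MeasurableSingletonClass (α i)] :
    MeasurableSingletonClass (Σ i, α i) where
  measurableSet_singleton := by
    rintro ⟨j, a⟩
    rw [Sigma.measurableSet_iff]
    intro i
    apply Set.Subsingleton.measurableSet
    intro x hx y hy
    simp only [mem_preimage, mem_singleton_iff] at hx hy
    exact sigma_mk_injective (hx.trans hy.symm)

theorem Sigma.measurableSet_image_mk {ι : Type*} {α : ι → Type*} [∀ i, MeasurableSpace (α i)]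
    {i : ι} {s : Set (α i)} (hs : MeasurableSet s) : MeasurableSet (Sigma.mk i '' s) := by
  rw [Sigma.measurableSet_iff]
  intro j
  by_cases h : j = i
  · subst h
    rwa [preimage_image_eq _ sigma_mk_injective]
  · convert MeasurableSet.empty
    ext y
    simp only [mem_preimage, mem_image, mem_empty_iff_false, iff_false, not_exists, not_and]
    rintro x - hxy
    exact h (congrArg Sigma.fst hxy).symm

theorem Sigma.measurableEmbedding_mk {ι : Type*} {α : ι → Type*} [∀ i, MeasurableSpace (α i)]
    (i : ι) : MeasurableEmbedding (Sigma.mk i : α i → Σ i, α i) where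
  injective := sigma_mk_injective
  measurable := fun _ hs => Sigma.measurableSet_iff.1 hs i
  measurableSet_image' := fun _ hs => Sigma.measurableSet_image_mk hs

/-! ### The law of the uniform ordering and its semicontinuity. -/

section Orderings

variable {E : Type*} [MetricSpace E]

theorem orderings_eq_range {D : Set E} {Υ : Config E} {M : ℕ} {e : Fin M → D}
    (he : Function.Injective e) (hr : range (fun i => (e i : E)) = Υ.points ∩ D) :
    orderings D Υ = range fun σ : Equiv.Perm (Fin M) => (⟨M, e ∘ σ⟩ : VarVec D) := by
  apply Subset.antisymm
  · rintro ⟨k, w⟩ ⟨hw, hwr⟩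
    simp only at hw hwr
    have hE : ∀ {n : ℕ} {f : Fin n → D}, Function.Injective f →
        Function.Injective fun i => (f i : E) := fun hf => Subtype.val_injective.comp hf
    have hk : k = M := by
      have h1 := (hE hw).encard_range_fin
      have h2 := (hE he).encard_range_fin
      rw [hwr, ← hr, h2] at h1
      exact_mod_cast h1.symm
    subst hk
    have hrange : range w = range e := by
      apply Subtype.val_injective.image_injective
      rw [← range_comp, ← range_comp]
      exact hwr.trans hr.symm
    refine ⟨(Equiv.ofInjective w hw).trans
      ((Equiv.setCongr hrange).trans (Equiv.ofInjective e he).symm), ?_⟩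
    refine congrArg (Sigma.mk k) (funext fun i => ?_)
    simp only [Function.comp_apply, Equiv.trans_apply]
    rw [Equiv.apply_ofInjective_symm he]
    rfl
  · rintro _ ⟨σ, rfl⟩
    refine ⟨he.comp σ.injective, ?_⟩
    rw [← hr]
    exact σ.surjective.range_comp fun i => (e i : E)

/-- All orderings are permutations of a single one, so the uniform law is a proportion of
permutations. This allows configurations with equally many points to be compared permutation by
permutation. -/
theorem uniformOn_orderings [MeasurableSpace E] [BorelSpace E] {D : Set E} {Υ : Config E} {M : ℕ}
    {e : Fin M → D} (he : Function.Injective e) (hr : range (fun i => (e i : E)) = Υ.points ∩ D)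
    {O : Set (VarVec D)} (hO : MeasurableSet O) :
    uniformOn (orderings D Υ) O = ((univ : Set (Equiv.Perm (Fin M))).encard : ℝ≥0∞)⁻¹ *
      ({σ : Equiv.Perm (Fin M) | (⟨M, e ∘ σ⟩ : VarVec D) ∈ O}.encard : ℝ≥0∞) := by
  have hinj : Function.Injective fun σ : Equiv.Perm (Fin M) => (⟨M, e ∘ σ⟩ : VarVec D) := by
    intro σ τ h
    ext i : 1
    have := congrFun (sigma_mk_injective h) i
    exact he this
  have hm : MeasurableSet (orderings D Υ) := by
    rw [orderings_eq_range he hr]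
    exact (finite_range _).measurableSet
  rw [uniformOn, cond_apply hm, Measure.count_apply hm, Measure.count_apply (hm.inter hO),
    orderings_eq_range he hr, ← image_univ, hinj.encard_image, ← image_inter_preimage,
    hinj.encard_image, univ_inter]
  rfl

theorem exists_orderings {D : Set E} (hb : Bornology.IsBounded D) (Υ : Config E) :
    ∃ (M : ℕ) (e : Fin M → D), Function.Injective e ∧
      range (fun i => (e i : E)) = Υ.points ∩ D := by
  obtain ⟨M, x, hx, hr⟩ := (Υ.locallyFinite D hb).exists_injective_range_eq
  refine ⟨M, fun i => ⟨x i, ?_⟩, fun i j h => hx (congrArg Subtype.val h), hr⟩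
  have := hr ▸ mem_range_self i
  exact this.2

theorem VarVec.measurableSet_of_isOpen [SecondCountableTopology E] [MeasurableSpace E]
    [BorelSpace E] {D : Set E} {O : Set (VarVec D)} (hO : IsOpen O) : MeasurableSet O := by
  rw [Sigma.measurableSet_iff]
  exact fun i => (isOpen_sigma_iff.1 hO i).measurableSet

variable [ProperSpace E] [MeasurableSpace E] [BorelSpace E]

/-- Lower semicontinuity of the law of the uniform ordering, as long as the number of points in `D`
stays the same. -/
theorem eventually_uniformOn_orderings_le {D : Set E} (hD : IsOpen D)
    (hb : Bornology.IsBounded D) {O : Set (VarVec D)} (hO : IsOpen O) (Υ : Config E) :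
    ∀ᶠ Υ' in 𝓝 Υ, (Υ'.points ∩ D).encard = (Υ.points ∩ D).encard →
      uniformOn (orderings D Υ) O ≤ uniformOn (orderings D Υ') O := by
  obtain ⟨M, e, he, hr⟩ := exists_orderings hb Υ
  have heE : Function.Injective fun i => (e i : E) := Subtype.val_injective.comp he
  have hev : ∀ᶠ e' in 𝓝 e, ∀ σ : Equiv.Perm (Fin M),
      (⟨M, e ∘ σ⟩ : VarVec D) ∈ O → (⟨M, e' ∘ σ⟩ : VarVec D) ∈ O := by
    rw [eventually_all]
    intro σ
    by_cases h : (⟨M, e ∘ σ⟩ : VarVec D) ∈ O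
    · have hc : Continuous fun e' : Fin M → D => (⟨M, e' ∘ σ⟩ : VarVec D) := by
        refine continuous_sigmaMk.comp (continuous_pi fun i => ?_)
        exact continuous_apply (σ i)
      filter_upwards [hc.continuousAt.preimage_mem_nhds (hO.mem_nhds h)] with e' he' _
      exact he'
    · exact Eventually.of_forall fun _ h' => absurd h' h
  obtain ⟨δ, hδ, hev⟩ := Metric.eventually_nhds_iff.1 (hev.and (eventually_injective he))
  have hpts : ∀ᶠ Υ' in 𝓝 Υ, ∀ i, 1 ≤ (Υ'.points ∩ (Metric.ball (e i : E) δ ∩ D)).encard := by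
    rw [eventually_all]
    intro i
    filter_upwards [Υ.eventually_le_encard_inter (Metric.isOpen_ball.inter hD)
      (hb.subset inter_subset_right)] with Υ' h
    refine le_trans ?_ h
    rw [one_le_encard_iff_nonempty]
    have hi : (e i : E) ∈ Υ.points ∩ D := hr ▸ mem_range_self i
    exact ⟨e i, hi.1, Metric.mem_ball_self hδ, hi.2⟩
  filter_upwards [hpts] with Υ' hΥ' hcard
  simp only [one_le_encard_iff_nonempty] at hΥ'
  choose y hy using hΥ'
  let e' : Fin M → D := fun i => ⟨y i, (hy i).2.2⟩
  obtain ⟨h1, h2⟩ := hev (show dist e' e < δ from (dist_pi_lt_iff hδ).2 fun i => (hy i).2.1)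
  have h2E : Function.Injective fun i => (e' i : E) := Subtype.val_injective.comp h2
  have hr' : range (fun i => (e' i : E)) = Υ'.points ∩ D := by
    apply h2E.range_eq_of_subset
    · rintro _ ⟨i, rfl⟩
      exact ⟨(hy i).1, (hy i).2.2⟩
    · rw [hcard, ← hr, heE.encard_range_fin]
  have hOm := VarVec.measurableSet_of_isOpen hO
  rw [uniformOn_orderings he hr hOm, uniformOn_orderings h2 hr' hOm]
  gcongr
  exact h1 _

theorem measurable_uniformOn_orderings {D : Set E} (hD : IsOpen D)
    (hb : Bornology.IsBounded D) {O : Set (VarVec D)} (hO : IsOpen O) :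
    Measurable fun Υ : Config E => uniformOn (orderings D Υ) O := by
  refine measurable_of_Ioi fun a => ?_
  have hcount := Config.measurable_encard_inter_of_isOpen hD hb
  -- Semicontinuity holds only among configurations with the same count, so a superlevel set is open
  -- relative to each stratum. The implication inside the interior expresses this.
  have hset : ∀ M : ℕ, MeasurableSet
      ({Υ : Config E | (Υ.points ∩ D).encard = M} ∩
        interior {Υ : Config E | (Υ.points ∩ D).encard = M → a < uniformOn (orderings D Υ) O}) :=
    fun M => (hcount (t := {(M : ℕ∞)}) trivial).inter isOpen_interior.measurableSet
  convert MeasurableSet.iUnion hset using 1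
  ext Υ
  simp only [mem_preimage, mem_Ioi, mem_iUnion, Set.mem_inter_iff, Set.mem_ofPred_eq]
  constructor
  · intro h
    obtain ⟨M, hM⟩ := ENat.ne_top_iff_exists.1 (encard_ne_top_iff.2 (Υ.locallyFinite D hb))
    refine ⟨M, hM.symm, ?_⟩
    rw [mem_interior_iff_mem_nhds]
    filter_upwards [eventually_uniformOn_orderings_le hD hb hO Υ] with Υ' h1 h2
    exact h.trans_le (h1 (h2.trans hM))
  · rintro ⟨M, h1, h2⟩
    exact interior_subset h2 h1

/-- The defining law writes both sides as integrals of `uniformOn`. Almost surely the count in `D`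
and membership in `C` stabilise, so the integrands are lower semicontinuous along the sequence and
Fatou's lemma applies. -/
theorem IsUniformOrdering.measure_le_liminf {Ξ : Type*} [MeasurableSpace Ξ] {P : Measure Ξ}
    {D : Set E} (hD : IsOpen D) (hb : Bornology.IsBounded D) {X : Ξ → Config E}
    {Xn : ℕ → Ξ → Config E} (hX : Measurable X) (hXn : ∀ n, Measurable (Xn n))
    (hlim : ∀ᵐ ξ ∂P, Tendsto (fun n => Xn n ξ) atTop (𝓝 (X ξ)))
    (hfr : ∀ᵐ ξ ∂P, Disjoint (X ξ).points (frontier D))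
    {ζ : Ξ → VarVec D} {ζn : ℕ → Ξ → VarVec D}
    (hζ : IsUniformOrdering P D X ζ) (hζn : ∀ n, IsUniformOrdering P D (Xn n) (ζn n))
    {C : Set (Config E)} (hC : MeasurableSet C)
    (hCev : ∀ᵐ ξ ∂P, ∀ᶠ n in atTop, (Xn n ξ ∈ C ↔ X ξ ∈ C))
    {O : Set (VarVec D)} (hO : IsOpen O) :
    P (X ⁻¹' C ∩ ζ ⁻¹' O) ≤ liminf (fun n => P (Xn n ⁻¹' C ∩ ζn n ⁻¹' O)) atTop := by
  have hOm := VarVec.measurableSet_of_isOpen hO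
  have hu := measurable_uniformOn_orderings hD hb hO
  rw [hζ.law C O hC hOm]
  simp only [(hζn _).law C O hC hOm]
  rw [← lintegral_indicator (hX hC)]
  simp only [← lintegral_indicator (hXn _ hC)]
  refine le_trans (lintegral_mono_ae ?_)
    (lintegral_liminf_le fun n => (hu.comp (hXn n)).indicator (hXn n hC))
  filter_upwards [hlim, hfr, hCev] with ξ h1 h2 h3
  refine le_liminf_of_le (by isBoundedDefault) ?_
  filter_upwards [h3, h1.eventually (eventually_uniformOn_orderings_le hD hb hO (X ξ)),
    h1.eventually ((X ξ).eventually_encard_inter_eq hb h2)] with n k1 k2 k3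
  by_cases h : X ξ ∈ C
  · rw [indicator_of_mem (mem_preimage.2 h), indicator_of_mem (mem_preimage.2 (k1.2 h))]
    exact k2 k3
  · rw [indicator_of_notMem (mt mem_preimage.1 h)]
    exact zero_le

end Orderings

/-! ### Rational points, and the basis of outside events. -/

section RationalPoints

variable {d : ℕ}

/-- The point with the given rational coordinates. -/
def ratPoint (q : Fin d → ℚ) : EuclideanSpace ℝ (Fin d) :=
  WithLp.toLp 2 fun i => (q i : ℝ)

theorem isRationalPoint_ratPoint (q : Fin d → ℚ) : IsRationalPoint (ratPoint q) :=
  fun i => ⟨q i, rfl⟩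

theorem IsRationalPoint.mem_range {x : EuclideanSpace ℝ (Fin d)} (hx : IsRationalPoint x) :
    x ∈ range (ratPoint (d := d)) := by
  choose q hq using hx
  refine ⟨q, ?_⟩
  ext i
  exact (hq i).symm

theorem denseRange_ratPoint : DenseRange (ratPoint (d := d)) := by
  have h : DenseRange (Pi.map fun (_ : Fin d) (q : ℚ) => (q : ℝ)) :=
    DenseRange.piMap fun _ => Rat.denseRange_cast
  exact ((WithLp.toLp_surjective 2).denseRange).comp h (PiLp.continuous_toLp 2 _)

end RationalPoints

section OutBasis

variable {d : ℕ} {c : EuclideanSpace ℝ (Fin d)} {R : ℝ}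

theorem isCompact_closedAnnulus (r s : ℝ) : IsCompact (closedAnnulus c r s) := by
  apply Metric.isCompact_of_isClosed_isBounded
  · have h : Continuous fun x : EuclideanSpace ℝ (Fin d) => dist x c := by fun_prop
    exact IsClosed.inter (isClosed_le continuous_const h) (isClosed_le h continuous_const)
  · exact Metric.isBounded_closedBall.subset fun x hx => Metric.mem_closedBall.2 hx.2

theorem mem_annulus_of_lt {r s : ℝ} {x : EuclideanSpace ℝ (Fin d)} (h1 : r < dist x c)
    (h2 : dist x c < s) : closedAnnulus c r s ∈ 𝓝 x := by
  have h : ContinuousAt (fun y : EuclideanSpace ℝ (Fin d) => dist y c) x := by fun_prop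
  filter_upwards [h.eventually (lt_mem_nhds h1), h.eventually (gt_mem_nhds h2)] with y k1 k2
  exact ⟨k1.le, k2.le⟩

theorem frontier_closedAnnulus_subset (r s : ℝ) :
    frontier (closedAnnulus c r s) ⊆ Metric.sphere c r ∪ Metric.sphere c s := by
  intro x hx
  have hx1 := (isCompact_closedAnnulus r s).isClosed.frontier_subset hx
  by_contra h
  simp only [mem_union, Metric.mem_sphere, not_or] at h
  exact hx.2 (mem_interior_iff_mem_nhds.2 (mem_annulus_of_lt (lt_of_le_of_ne hx1.1 (Ne.symm h.1))
    (lt_of_le_of_ne hx1.2 h.2)))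

theorem notMem_ball_of_closedAnnulus_subset {r s : ℝ} (hr : 0 < r) (hrs : r < s)
    (h : closedAnnulus c r s ⊆ (Metric.ball c R)ᶜ) {x : EuclideanSpace ℝ (Fin d)}
    (hx : r ≤ dist x c) : x ∉ Metric.ball c R := by
  have hpos : 0 < dist x c := hr.trans_le hx
  have hn : ‖x - c‖ = dist x c := (dist_eq_norm x c).symm
  -- Scaling `x - c` gives a point of the inner sphere, which shows `R ≤ r`. The point `x` itself
  -- guarantees that the sphere is not empty.
  have hy : dist (c + (r / dist x c) • (x - c)) c = r := by
    rw [dist_eq_norm, add_sub_cancel_left, norm_smul, hn, Real.norm_eq_abs,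
      abs_of_pos (div_pos hr hpos)]
    field_simp
  have := h (show c + (r / dist x c) • (x - c) ∈ closedAnnulus c r s from
    ⟨hy.ge, hy.le.trans hrs.le⟩)
  simp only [mem_compl_iff, Metric.mem_ball, hy, not_lt] at this
  simpa using this.trans hx

variable {D : Set (EuclideanSpace ℝ (Fin d))}

/-- Small rational balls around the points of `Υ` in the annulus, with the count in the annulus
fixed, define the basis set. Each of its members has exactly one annulus point in each ball, hence a
list of points close to `x`. -/
theorem exists_mem_outBasis_of_eventually {Υ : OutConfig D} {r s : ℚ} (hr : 0 < r) (hrs : r < s)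
    (hann : closedAnnulus c (r : ℝ) s ⊆ Dᶜ)
    (h1 : Disjoint Υ.1.points (Metric.sphere c r)) (h2 : Disjoint Υ.1.points (Metric.sphere c s))
    {n : ℕ} {x : Fin n → EuclideanSpace ℝ (Fin d)} (hx : Function.Injective x)
    (hxr : range x = Υ.1.points ∩ closedAnnulus c (r : ℝ) s) {p : OutConfig D → Prop}
    (hp : ∀ᶠ x' in 𝓝 x, ∀ Υ' : OutConfig D, Function.Injective x' →
      range x' = Υ'.1.points ∩ closedAnnulus c (r : ℝ) s → p Υ') :
    ∃ F ∈ outBasis D c, Υ ∈ F ∧ ∀ Υ' ∈ F, p Υ' := by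
  have hmem : ∀ i, x i ∈ Υ.1.points ∩ closedAnnulus c (r : ℝ) s := fun i => hxr ▸ mem_range_self i
  have hann' : ∀ᶠ x' in 𝓝 x, ∀ i, x' i ∈ closedAnnulus c (r : ℝ) s := by
    rw [eventually_all]
    intro i
    refine (continuous_apply i).continuousAt.preimage_mem_nhds (mem_annulus_of_lt ?_ ?_)
    · exact lt_of_le_of_ne (hmem i).2.1 fun h => disjoint_left.1 h1 (hmem i).1 h.symm
    · exact lt_of_le_of_ne (hmem i).2.2 fun h => disjoint_left.1 h2 (hmem i).1 h
  obtain ⟨δ, hδ, hev⟩ := Metric.eventually_nhds_iff.1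
    (hp.and ((eventually_injective hx).and hann'))
  obtain ⟨t, ht1, ht2⟩ := exists_rat_btwn (show δ / 4 < δ / 2 by linarith)
  have htpos : 0 < t := by
    have : (0 : ℝ) < t := by linarith
    exact_mod_cast this
  have hk : ∀ i, ∃ k, dist (x i) (ratPoint k) < δ / 4 :=
    fun i => denseRange_ratPoint.exists_dist_lt (x i) (by linarith)
  choose k hk using hk
  have hball : ∀ i, ∀ y ∈ Metric.ball (ratPoint (k i)) (t : ℝ), dist y (x i) < δ := by
    intro i y hy
    have h3 := dist_triangle_right y (x i) (ratPoint (k i))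
    have h4 := hk i
    have h5 := Metric.mem_ball.1 hy
    linarith
  have hxball : ∀ i, x i ∈ Metric.ball (ratPoint (k i)) (t : ℝ) :=
    fun i => Metric.mem_ball.2 ((hk i).trans ht1)
  have hdisj : Pairwise fun i j => Disjoint (Metric.ball (ratPoint (k i)) (t : ℝ))
      (Metric.ball (ratPoint (k j)) (t : ℝ)) := by
    intro i j hij
    rw [disjoint_left]
    intro y hy1 hy2
    -- A point common to two balls could replace both `x i` and `x j`. The new list would be within
    -- `δ` of `x` without being injective.
    have hd : dist (Function.update (Function.update x i y) j y) x < δ := by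
      rw [dist_pi_lt_iff hδ]
      intro l
      rcases eq_or_ne l j with rfl | hlj
      · simpa using hball _ y hy2
      · rcases eq_or_ne l i with rfl | hli
        · simpa [hlj] using hball _ y hy1
        · simpa [hlj, hli] using hδ
    apply hij
    apply (hev hd).2.1
    simp [hij]
  have hsub : ∀ i, Metric.ball (ratPoint (k i)) (t : ℝ) ⊆ closedAnnulus c (r : ℝ) s := by
    intro i y hy
    have hd : dist (Function.update x i y) x < δ := by
      rw [dist_pi_lt_iff hδ]
      intro l
      rcases eq_or_ne l i with rfl | hli
      · simpa using hball _ y hy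
      · simpa [hli] using hδ
    simpa using (hev hd).2.2 i
  refine ⟨_, ⟨n, r, s, fun i => ratPoint (k i), fun _ => t, hr, hrs, hann,
    fun i => ⟨isRationalPoint_ratPoint _, htpos⟩, hdisj, fun i => inter_subset_left.trans (hsub i),
    rfl⟩, ⟨?_, fun i => ?_⟩, ?_⟩
  · rw [← hxr, hx.encard_range_fin]
  · refine encard_eq_one.2 ⟨x i, Subset.antisymm ?_ ?_⟩
    · rintro y ⟨hy1, hy2⟩
      have : y ∈ range x := hxr ▸ ⟨hy1, hsub i hy2⟩
      obtain ⟨j, rfl⟩ := this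
      by_contra hne
      have hij : i ≠ j := fun h => hne (by rw [h]; rfl)
      exact disjoint_left.1 (hdisj hij) hy2 (hxball j)
    · rintro _ rfl
      exact ⟨(hmem i).1, hxball i⟩
  · rintro Υ' ⟨k1, k2⟩
    have k3 : ∀ i, ∃ y, y ∈ Υ'.1.points ∩ Metric.ball (ratPoint (k i)) (t : ℝ) := by
      intro i
      obtain ⟨y, hy⟩ := encard_eq_one.1 (k2 i)
      exact ⟨y, hy ▸ rfl⟩
    choose x' hx' using k3
    obtain ⟨k4, k5, -⟩ := hev ((dist_pi_lt_iff hδ).2 fun i => hball i (x' i) (hx' i).2)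
    refine k4 Υ' k5 (k5.range_eq_of_subset ?_ k1.le)
    rintro _ ⟨i, rfl⟩
    exact ⟨(hx' i).1, hsub i (hx' i).2⟩

/-- Outside configurations avoid `D`, so their points in `K` all occur in the list. Whether a listed
point lies in `K` is stable off the frontier of `K`. -/
theorem eventually_encard_inter_eq_of_perturbation {E : Type*} [MetricSpace E] {D K S : Set E}
    {Υ : OutConfig D} {n : ℕ} {x : Fin n → E} (hx : Function.Injective x)
    (hxr : range x = Υ.1.points ∩ S) (hK : K ∩ Dᶜ ⊆ S)
    (hfr : Disjoint Υ.1.points (frontier K)) :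
    ∀ᶠ x' in 𝓝 x, ∀ Υ' : OutConfig D, Function.Injective x' → range x' = Υ'.1.points ∩ S →
      (Υ'.1.points ∩ K).encard = (Υ.1.points ∩ K).encard := by
  have himg : ∀ (Υ' : OutConfig D) (x' : Fin n → E), Function.Injective x' →
      range x' = Υ'.1.points ∩ S → (Υ'.1.points ∩ K).encard = {i | x' i ∈ K}.encard := by
    intro Υ' x' hx' hr'
    rw [← hx'.encard_image]
    congr 1
    ext y
    constructor
    · rintro ⟨h1, h2⟩
      obtain ⟨i, rfl⟩ : y ∈ range x' := hr' ▸ ⟨h1, hK ⟨h2, Υ'.2 h1⟩⟩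
      exact ⟨i, h2, rfl⟩
    · rintro ⟨i, hi, rfl⟩
      have : x' i ∈ range x' := mem_range_self i
      rw [hr'] at this
      exact ⟨this.1, hi⟩
  have hev : ∀ᶠ x' in 𝓝 x, ∀ i, (x' i ∈ K ↔ x i ∈ K) := by
    rw [eventually_all]
    intro i
    have hi : x i ∈ Υ.1.points := (hxr ▸ mem_range_self i : x i ∈ Υ.1.points ∩ S).1
    have hnf : x i ∉ frontier K := disjoint_left.1 hfr hi
    by_cases hc : x i ∈ closure K
    · have hint : x i ∈ interior K := by
        by_contra h
        exact hnf ⟨hc, h⟩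
      filter_upwards [(continuous_apply i).continuousAt.preimage_mem_nhds
        (isOpen_interior.mem_nhds hint)] with x' hx'
      exact iff_of_true (interior_subset hx') (interior_subset hint)
    · filter_upwards [(continuous_apply i).continuousAt.preimage_mem_nhds
        (isClosed_closure.isOpen_compl.mem_nhds hc)] with x' hx'
      exact iff_of_false (fun h => hx' (subset_closure h)) fun h => hc (subset_closure h)
  filter_upwards [hev] with x' h1 Υ' h2 h3
  rw [himg Υ' x' h2 h3, himg Υ x hx hxr]
  simp only [h1]

/-- No points on the boundary of the ball, nor on any sphere with rational radius around the centre
or around a rational point. -/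
structure IsGeneric (c : EuclideanSpace ℝ (Fin d)) (R : ℝ) (S : Set (EuclideanSpace ℝ (Fin d))) :
    Prop where
  boundary : Disjoint S (Metric.sphere c R)
  centred : ∀ r : ℚ, 0 < r → Disjoint S (Metric.sphere c r)
  rational : ∀ q, IsRationalPoint q → ∀ t : ℚ, 0 < t → Disjoint S (Metric.sphere q t)

theorem IsGeneric.mono {S T : Set (EuclideanSpace ℝ (Fin d))} (h : IsGeneric c R T) (hST : S ⊆ T) :
    IsGeneric c R S :=
  ⟨h.1.mono_left hST, fun r hr => (h.2 r hr).mono_left hST,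
    fun q hq t ht => (h.3 q hq t ht).mono_left hST⟩

theorem IsGeneric.disjoint_frontier_closedAnnulus {S : Set (EuclideanSpace ℝ (Fin d))}
    (h : IsGeneric c R S) {r s : ℚ} (hr : 0 < r) (hrs : r < s) :
    Disjoint S (frontier (closedAnnulus c (r : ℝ) s)) :=
  ((h.2 r hr).union_right (h.2 s (hr.trans hrs))).mono_right (frontier_closedAnnulus_subset _ _)

theorem IsGeneric.disjoint_frontier_ball {S : Set (EuclideanSpace ℝ (Fin d))}
    (h : IsGeneric c R S) {q : EuclideanSpace ℝ (Fin d)} (hq : IsRationalPoint q) {t : ℚ}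
    (ht : 0 < t) : Disjoint S (frontier (Metric.ball q (t : ℝ))) :=
  (h.3 q hq t ht).mono_right Metric.frontier_ball_subset_sphere

/-- Whether a configuration belongs to given members of the basis is decided, near a generic
configuration, by its points in a large annulus. -/
theorem IsGeneric.exists_hull {Υ : OutConfig (Metric.ball c R)} (hg : IsGeneric c R Υ.1.points)
    {F : Set (Set (OutConfig (Metric.ball c R)))} (hF : F.Finite)
    (hFb : F ⊆ outBasis (Metric.ball c R) c) :
    ∃ r s : ℚ, 0 < r ∧ r < s ∧ (∀ x, (r : ℝ) ≤ dist x c → x ∉ Metric.ball c R) ∧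
      ∀ B ∈ F, ∀ r' s' : ℚ, r' ≤ r → s ≤ s' → ∀ (n : ℕ) (x : Fin n → EuclideanSpace ℝ (Fin d)),
        Function.Injective x → range x = Υ.1.points ∩ closedAnnulus c (r' : ℝ) s' →
        ∀ᶠ x' in 𝓝 x, ∀ Υ' : OutConfig (Metric.ball c R), Function.Injective x' →
          range x' = Υ'.1.points ∩ closedAnnulus c (r' : ℝ) s' → (Υ' ∈ B ↔ Υ ∈ B) := by
  induction F, hF using Set.Finite.induction_on with
  | empty =>
    obtain ⟨r, hr⟩ := exists_rat_gt (max R 0)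
    refine ⟨r, r + 1, ?_, by linarith, fun x hx => ?_, fun B hB => absurd hB (notMem_empty B)⟩
    · exact_mod_cast (le_max_right R 0).trans_lt hr
    · simpa using ((le_max_left R 0).trans hr.le).trans hx
  | @insert B F _ _ ih =>
    obtain ⟨r, s, hr, hrs, hv, h⟩ := ih ((subset_insert B F).trans hFb)
    obtain ⟨n₁, r₁, s₁, q, t, hr₁, hrs₁, hann, hqt, -, hsub, rfl⟩ := hFb (mem_insert B F)
    have hr₁' : (0 : ℝ) < r₁ := by exact_mod_cast hr₁
    have hrs₁' : (r₁ : ℝ) < s₁ := by exact_mod_cast hrs₁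
    -- The induction hypothesis covers every larger annulus, so the hull may be enlarged to contain
    -- the annulus of the new set.
    refine ⟨min r r₁, max s s₁, lt_min hr hr₁,
      (min_le_left _ _).trans_lt (hrs.trans_le (le_max_left _ _)), ?_, ?_⟩
    · intro x hx
      rw [Rat.cast_min, min_le_iff] at hx
      rcases hx with hx | hx
      · exact hv x hx
      · exact notMem_ball_of_closedAnnulus_subset hr₁' hrs₁' hann hx
    · rintro B' hB' r' s' hr' hs' n x hx hxr
      rcases hB' with rfl | hB'
      · have hA : closedAnnulus c (r₁ : ℝ) s₁ ⊆ closedAnnulus c (r' : ℝ) s' := by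
          intro y hy
          have e1 : (r' : ℝ) ≤ r₁ := by exact_mod_cast hr'.trans (min_le_right _ _)
          have e2 : (s₁ : ℝ) ≤ s' := by exact_mod_cast (le_max_right _ _).trans hs'
          exact ⟨e1.trans hy.1, hy.2.trans e2⟩
        have e1 := eventually_encard_inter_eq_of_perturbation hx hxr
          (inter_subset_left.trans hA) (hg.disjoint_frontier_closedAnnulus hr₁ hrs₁)
        have e2 := eventually_all.2 fun i => eventually_encard_inter_eq_of_perturbation hx hxr
          ((hsub i).trans hA) (hg.disjoint_frontier_ball (hqt i).1 (hqt i).2)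
        filter_upwards [e1, e2] with x' k1 k2 Υ' k3 k4
        simp only [k1 Υ' k3 k4, k2 _ Υ' k3 k4]
      · exact h B' hB' r' s' (hr'.trans (min_le_left _ _)) ((le_max_left _ _).trans hs') n x hx hxr

theorem IsGeneric.exists_mem_outBasis_forall_iff {Υ : OutConfig (Metric.ball c R)}
    (hg : IsGeneric c R Υ.1.points) {F : Set (Set (OutConfig (Metric.ball c R)))} (hF : F.Finite)
    (hFb : F ⊆ outBasis (Metric.ball c R) c) :
    ∃ G ∈ outBasis (Metric.ball c R) c, Υ ∈ G ∧ ∀ Υ' ∈ G, ∀ B ∈ F, (Υ' ∈ B ↔ Υ ∈ B) := by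
  obtain ⟨r, s, hr, hrs, hv, h⟩ := hg.exists_hull hF hFb
  obtain ⟨n, x, hx, hxr⟩ := (Υ.1.locallyFinite (closedAnnulus c (r : ℝ) s)
    (isCompact_closedAnnulus _ _).isBounded).exists_injective_range_eq
  refine exists_mem_outBasis_of_eventually hr hrs (fun y hy => hv y hy.1) (hg.2 r hr)
    (hg.2 s (hr.trans hrs)) hx hxr ?_
  filter_upwards [(eventually_all_finite hF).2 fun B hB =>
    h B hB r s le_rfl le_rfl n x hx hxr] with x' h1 Υ' h2 h3 B hB
  exact h1 B hB Υ' h2 h3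

/-- Removing a ball of rational radius `r ≥ R` leaves points which an admissible annulus can see,
and a neighbourhood constrains only those within a bounded distance. -/
theorem IsGeneric.exists_mem_outBasis_of_out_mem {Υ : OutConfig (Metric.ball c R)}
    (hg : IsGeneric c R Υ.1.points) {r : ℚ} (hr : 0 < r) (hRr : R ≤ r)
    {U : Set (Config (EuclideanSpace ℝ (Fin d)))} (hU : IsOpen U)
    (hΥ : (Υ.1.out (Metric.ball c r)).1 ∈ U) :
    ∃ G ∈ outBasis (Metric.ball c R) c, Υ ∈ G ∧
      ∀ Υ' ∈ G, (Υ'.1.out (Metric.ball c r)).1 ∈ U := by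
  obtain ⟨s₀, h⟩ := Config.exists_radius_forall_eventually_mem c (hU.mem_nhds hΥ)
  obtain ⟨s, hs⟩ := exists_rat_gt (max (r : ℝ) s₀)
  have hrs : r < s := by exact_mod_cast (le_max_left _ _).trans_lt hs
  have hs₀ : s₀ < s := (le_max_right _ _).trans_lt hs
  obtain ⟨n, x, hx, hxr⟩ := (Υ.1.locallyFinite (closedAnnulus c (r : ℝ) s)
    (isCompact_closedAnnulus _ _).isBounded).exists_injective_range_eq
  have key : ∀ (Υ' : OutConfig (Metric.ball c R)) (x' : Fin n → EuclideanSpace ℝ (Fin d)),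
      range x' = Υ'.1.points ∩ closedAnnulus c (r : ℝ) s →
      range x' ⊆ (Υ'.1.out (Metric.ball c r)).1.points ∧
      (Υ'.1.out (Metric.ball c r)).1.points ∩ Metric.ball c s₀ ⊆ range x' := by
    intro Υ' x' hr'
    rw [hr']
    constructor
    · exact fun y hy => ⟨hy.1, fun hb => (Metric.mem_ball.1 hb).not_ge hy.2.1⟩
    · exact fun y hy => ⟨hy.1.1, not_lt.1 fun hb => hy.1.2 (Metric.mem_ball.2 hb),
        (Metric.mem_ball.1 hy.2).le.trans hs₀.le⟩
  refine exists_mem_outBasis_of_eventually hr hrs (fun y hy hb => ?_) (hg.2 r hr)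
    (hg.2 s (hr.trans hrs)) hx hxr ?_
  · exact ((Metric.mem_ball.1 hb).trans_le hRr).not_ge hy.1
  · filter_upwards [h n x hx (key Υ x hxr).1 (key Υ x hxr).2] with x' h1 Υ' h2 h3
    exact h1 _ h2 (key Υ' x' h3).1 (key Υ' x' h3).2

theorem measurableSet_of_mem_outBasis {F : Set (OutConfig D)} (hF : F ∈ outBasis D c) :
    MeasurableSet F := by
  obtain ⟨n, r, s, q, t, -, -, -, -, -, -, rfl⟩ := hF
  have h1 : MeasurableSet {Υ : OutConfig D |
      (Υ.1.points ∩ closedAnnulus c (r : ℝ) s).encard = n} :=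
    ((Config.measurable_encard_inter_of_isCompact (isCompact_closedAnnulus _ _)).comp
      measurable_subtype_coe) (t := {(n : ℕ∞)}) trivial
  have h2 : ∀ i, MeasurableSet {Υ : OutConfig D |
      (Υ.1.points ∩ Metric.ball (q i) (t i)).encard = 1} := fun i =>
    ((Config.measurable_encard_inter_of_isOpen Metric.isOpen_ball Metric.isBounded_ball).comp
      measurable_subtype_coe) (t := {(1 : ℕ∞)}) trivial
  convert h1.inter (MeasurableSet.iInter h2) using 1
  ext Υ
  simp

theorem countable_outBasis : (outBasis D c).Countable := by
  let f : (Σ n : ℕ, ℚ × ℚ × (Fin n → Fin d → ℚ) × (Fin n → ℚ)) → Set (OutConfig D) := fun a =>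
    {Υ | (Υ.1.points ∩ closedAnnulus c (a.2.1 : ℝ) a.2.2.1).encard = a.1 ∧
      ∀ i, (Υ.1.points ∩ Metric.ball (ratPoint (a.2.2.2.1 i)) (a.2.2.2.2 i)).encard = 1}
  refine (countable_range f).mono ?_
  rintro F ⟨n, r, s, q, t, -, -, -, h, -, -, rfl⟩
  choose k hk using fun i => (h i).1.mem_range
  exact ⟨⟨n, r, s, k, t⟩, by simp only [f, hk]⟩

end OutBasis

/-! ### Almost sure genericity. -/

section Generic

variable {Ξ : Type*} [MeasurableSpace Ξ] {P : Measure Ξ} {d : ℕ}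
  {X : Ξ → Config (EuclideanSpace ℝ (Fin d))}

theorem ae_disjoint_of_firstIntensity_eq_zero (hX : Measurable X)
    {K : Set (EuclideanSpace ℝ (Fin d))} (hK : IsCompact K) (h0 : firstIntensity P X K = 0) :
    ∀ᵐ ξ ∂P, Disjoint (X ξ).points K := by
  have hm : Measurable fun ξ => (((X ξ).points ∩ K).encard : ℝ≥0∞) :=
    (Measurable.of_discrete (f := fun n : ℕ∞ => (n : ℝ≥0∞))).comp
      ((Config.measurable_encard_inter_of_isCompact hK).comp hX)
  have h := (lintegral_eq_zero_iff hm).1 h0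
  filter_upwards [h] with ξ hξ
  rw [disjoint_iff_inter_eq_empty, ← encard_eq_zero]
  simpa using hξ

/-- Spheres of positive radius are Lebesgue null, and only countably many are involved. -/
theorem ae_isGeneric (hX : Measurable X)
    (hint : ∀ K : Set (EuclideanSpace ℝ (Fin d)), MeasurableSet K → volume K = 0 →
      firstIntensity P X K = 0) (c : EuclideanSpace ℝ (Fin d)) {R : ℝ} (hR : 0 < R) :
    ∀ᵐ ξ ∂P, IsGeneric c R (X ξ).points := by
  have hs : ∀ (q : EuclideanSpace ℝ (Fin d)) (t : ℝ), 0 < t →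
      ∀ᵐ ξ ∂P, Disjoint (X ξ).points (Metric.sphere q t) := fun q t ht =>
    ae_disjoint_of_firstIntensity_eq_zero hX (isCompact_sphere q t)
      (hint _ Metric.isClosed_sphere.measurableSet
        (Measure.addHaar_sphere_of_ne_zero _ _ ht.ne'))
  have h2 : ∀ᵐ ξ ∂P, ∀ r : ℚ, 0 < r → Disjoint (X ξ).points (Metric.sphere c r) := by
    rw [ae_all_iff]
    intro r
    by_cases hr : 0 < r
    · filter_upwards [hs c r (by exact_mod_cast hr)] with ξ h _ using h
    · exact Eventually.of_forall fun _ h => absurd h hr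
  have h3 : ∀ᵐ ξ ∂P, ∀ (k : Fin d → ℚ) (t : ℚ), 0 < t →
      Disjoint (X ξ).points (Metric.sphere (ratPoint k) t) := by
    rw [ae_all_iff]
    intro k
    rw [ae_all_iff]
    intro r
    by_cases hr : 0 < r
    · filter_upwards [hs (ratPoint k) r (by exact_mod_cast hr)] with ξ h _ using h
    · exact Eventually.of_forall fun _ h => absurd h hr
  filter_upwards [hs c R hR, h2, h3] with ξ k1 k2 k3
  refine ⟨k1, k2, fun q hq t ht => ?_⟩
  obtain ⟨k, rfl⟩ := hq.mem_range
  exact k3 k t ht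

end Generic

/-! ### Approximation of outside events by finite unions of basis sets. -/

theorem tendsto_measure_zero_of_ae_eventually_notMem {Ξ : Type*} [MeasurableSpace Ξ]
    {P : Measure Ξ} [IsFiniteMeasure P] {S : ℕ → Set Ξ} (hS : ∀ k, MeasurableSet (S k))
    (h : ∀ᵐ ξ ∂P, ∀ᶠ k in atTop, ξ ∉ S k) : Tendsto (fun k => P (S k)) atTop (𝓝 0) := by
  rw [← measure_empty (μ := P)]
  refine tendsto_measure_of_ae_tendsto_indicator_of_isFiniteMeasure atTop MeasurableSet.empty hS ?_
  filter_upwards [h] with ξ hξ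
  filter_upwards [hξ] with k hk
  simpa using hk

section Approx

variable {d : ℕ} {c : EuclideanSpace ℝ (Fin d)} {R : ℝ} {D : Set (EuclideanSpace ℝ (Fin d))}
  {Ξ : Type*} [MeasurableSpace Ξ] {P : Measure Ξ} {Y : Ξ → OutConfig D}

/-- The event `Y ∈ U` is approximated by the events that `Y` lies in finite unions of sets of the
basis. -/
def BasisApprox (c : EuclideanSpace ℝ (Fin d)) (P : Measure Ξ) (Y : Ξ → OutConfig D)
    (U : Set (OutConfig D)) : Prop :=
  ∀ ε : ℝ≥0∞, ε ≠ 0 → ∃ F : Set (Set (OutConfig D)), F.Finite ∧ F ⊆ outBasis D c ∧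
    P (symmDiff (Y ⁻¹' U) (Y ⁻¹' ⋃₀ F)) ≤ ε

theorem basisApprox_sUnion {F : Set (Set (OutConfig D))} (hF : F.Finite)
    (hFb : F ⊆ outBasis D c) : BasisApprox c P Y (⋃₀ F) :=
  fun ε _ => ⟨F, hF, hFb, by simp⟩

theorem BasisApprox.of_forall_exists {U : Set (OutConfig D)}
    (h : ∀ ε : ℝ≥0∞, ε ≠ 0 → ∃ V, BasisApprox c P Y V ∧ P (symmDiff (Y ⁻¹' U) (Y ⁻¹' V)) ≤ ε) :
    BasisApprox c P Y U := by
  intro ε hε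
  obtain ⟨V, hV, hUV⟩ := h (ε / 2) (ENNReal.half_pos hε).ne'
  obtain ⟨F, hF, hFb, hVF⟩ := hV (ε / 2) (ENNReal.half_pos hε).ne'
  refine ⟨F, hF, hFb, ?_⟩
  calc _ ≤ P (symmDiff (Y ⁻¹' U) (Y ⁻¹' V)) + P (symmDiff (Y ⁻¹' V) (Y ⁻¹' ⋃₀ F)) :=
        measure_symmDiff_le _ _ _
    _ ≤ ε / 2 + ε / 2 := add_le_add hUV hVF
    _ = ε := ENNReal.add_halves ε

theorem BasisApprox.union {U V : Set (OutConfig D)} (hU : BasisApprox c P Y U)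
    (hV : BasisApprox c P Y V) : BasisApprox c P Y (U ∪ V) := by
  intro ε hε
  obtain ⟨F, hF, hFb, hUF⟩ := hU (ε / 2) (ENNReal.half_pos hε).ne'
  obtain ⟨G, hG, hGb, hVG⟩ := hV (ε / 2) (ENNReal.half_pos hε).ne'
  refine ⟨F ∪ G, hF.union hG, union_subset hFb hGb, ?_⟩
  calc _ ≤ P (symmDiff (Y ⁻¹' U) (Y ⁻¹' ⋃₀ F) ∪ symmDiff (Y ⁻¹' V) (Y ⁻¹' ⋃₀ G)) := by
        refine measure_mono ?_
        rw [sUnion_union, preimage_union, preimage_union]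
        intro ξ
        simp only [Set.mem_symmDiff, Set.mem_union]
        tauto
    _ ≤ ε / 2 + ε / 2 := (measure_union_le _ _).trans (add_le_add hUF hVG)
    _ = ε := ENNReal.add_halves ε

variable [IsFiniteMeasure P]

theorem BasisApprox.of_ae_eventually (hY : Measurable Y) {U : Set (OutConfig D)}
    (hU : MeasurableSet U) {V : ℕ → Set (OutConfig D)} (hVm : ∀ k, MeasurableSet (V k))
    (hV : ∀ k, BasisApprox c P Y (V k))
    (h : ∀ᵐ ξ ∂P, ∀ᶠ k in atTop, (Y ξ ∈ V k ↔ Y ξ ∈ U)) : BasisApprox c P Y U := by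
  refine BasisApprox.of_forall_exists fun ε hε => ?_
  have ht : Tendsto (fun k => P (symmDiff (Y ⁻¹' U) (Y ⁻¹' V k))) atTop (𝓝 0) := by
    refine tendsto_measure_zero_of_ae_eventually_notMem
      (fun k => (hY hU).symmDiff (hY (hVm k))) ?_
    filter_upwards [h] with ξ hξ
    filter_upwards [hξ] with k hk
    simp [Set.mem_symmDiff, hk]
  obtain ⟨k, hk⟩ := (ht.eventually (gt_mem_nhds (pos_iff_ne_zero.2 hε))).exists
  exact ⟨V k, hV k, hk.le⟩

theorem BasisApprox.iUnion (hY : Measurable Y) {U : ℕ → Set (OutConfig D)}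
    (hUm : ∀ k, MeasurableSet (U k)) (hU : ∀ k, BasisApprox c P Y (U k)) :
    BasisApprox c P Y (⋃ k, U k) := by
  refine BasisApprox.of_ae_eventually hY (MeasurableSet.iUnion hUm) (V := accumulate U)
    (fun k => MeasurableSet.biUnion (to_countable _) fun i _ => hUm i) (fun k => ?_) ?_
  · induction k with
    | zero => simpa [accumulate_def] using hU 0
    | succ k ih =>
      rw [accumulate_succ]
      exact ih.union (hU (k + 1))
  · refine Eventually.of_forall fun ξ => ?_
    by_cases h : Y ξ ∈ ⋃ k, U k
    · obtain ⟨k, hk⟩ := mem_iUnion.1 h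
      filter_upwards [eventually_ge_atTop k] with n hn
      exact iff_of_true (mem_accumulate.2 ⟨k, hn, hk⟩) h
    · exact Eventually.of_forall fun n => iff_of_false
        (fun hn => h (accumulate_subset_iUnion n hn)) h

/-- As the basis is countable, `U` agrees almost surely with a countable union of basis sets. -/
theorem BasisApprox.of_ae_exists_mem (hY : Measurable Y) {U : Set (OutConfig D)}
    (hU : MeasurableSet U)
    (h : ∀ᵐ ξ ∂P, Y ξ ∈ U → ∃ G ∈ outBasis D c, Y ξ ∈ G ∧ G ⊆ U) : BasisApprox c P Y U := by
  -- The empty set is added so that the family can be enumerated even when no basis set lies in `U`.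
  obtain ⟨f, hf⟩ := ((countable_outBasis (D := D) (c := c)).mono
    (show {G | G ∈ outBasis D c ∧ G ⊆ U} ⊆ _ from fun G hG => hG.1)).insert ∅ |>.exists_eq_range
      (insert_nonempty _ _)
  have hfr : ∀ k, f k = ∅ ∨ (f k ∈ outBasis D c ∧ f k ⊆ U) := fun k => by
    have : f k ∈ insert ∅ {G | G ∈ outBasis D c ∧ G ⊆ U} := hf ▸ mem_range_self k
    exact this
  have hfm : ∀ k, MeasurableSet (f k) := fun k => by
    rcases hfr k with h | h
    · rw [h]
      exact MeasurableSet.empty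
    · exact measurableSet_of_mem_outBasis h.1
  have hfa : ∀ k, BasisApprox c P Y (f k) := fun k => by
    rcases hfr k with h | h
    · rw [h]
      simpa using basisApprox_sUnion (P := P) (Y := Y) (finite_empty) (empty_subset (outBasis D c))
    · simpa using basisApprox_sUnion (P := P) (Y := Y) (finite_singleton (f k))
        (singleton_subset_iff.2 h.1)
  refine BasisApprox.of_ae_eventually hY hU (V := fun _ => ⋃ k, f k)
    (fun _ => MeasurableSet.iUnion hfm) (fun _ => BasisApprox.iUnion hY hfm hfa) ?_
  filter_upwards [h] with ξ hξ
  refine Eventually.of_forall fun _ => ⟨fun h' => ?_, fun h' => ?_⟩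
  · obtain ⟨k, hk⟩ := mem_iUnion.1 h'
    rcases hfr k with h | h
    · rw [h] at hk
      exact absurd hk (notMem_empty _)
    · exact h.2 hk
  · obtain ⟨G, hG, hGm, hGU⟩ := hξ h'
    obtain ⟨k, rfl⟩ : G ∈ range f := hf ▸ mem_insert_of_mem _ ⟨hG, hGU⟩
    exact mem_iUnion.2 ⟨k, hGm⟩

theorem eventually_out_ball_eq {Υ : OutConfig (Metric.ball c R)}
    (h : Disjoint Υ.1.points (Metric.sphere c R)) :
    ∀ᶠ r in 𝓝[>] R, (Υ.1.out (Metric.ball c r)).1 = Υ.1 := by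
  have hfin := Υ.1.locallyFinite (Metric.ball c (R + 1)) Metric.isBounded_ball
  have hev : ∀ᶠ r in 𝓝[>] R, ∀ y ∈ Υ.1.points ∩ Metric.ball c (R + 1), r < dist y c := by
    refine (eventually_all_finite hfin).2 fun y hy => ?_
    have hlt : R < dist y c := by
      refine lt_of_le_of_ne ?_ fun he => disjoint_left.1 h hy.1 he.symm
      simpa using Υ.2 hy.1
    exact eventually_nhdsWithin_of_eventually_nhds (gt_mem_nhds hlt)
  have h1 : ∀ᶠ r in 𝓝[>] R, r < R + 1 :=
    eventually_nhdsWithin_of_eventually_nhds (gt_mem_nhds (by linarith))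
  filter_upwards [hev, h1] with r hr hr1
  have hpts : (Υ.1.out (Metric.ball c r)).1.points = Υ.1.points := by
    refine sdiff_subset.antisymm fun y hy => ⟨hy, fun hb => ?_⟩
    have hb' := Metric.mem_ball.1 hb
    exact lt_asymm hb' (hr y ⟨hy, Metric.mem_ball.2 (hb'.trans hr1)⟩)
  cases hΥ : (Υ.1.out (Metric.ball c r)).1
  cases hΥ' : Υ.1
  simp_all

/-- Basis annuli have rational inradius and may miss points close to the sphere of radius `R`. So a
larger ball is removed, with rational radii decreasing to `R`; a generic configuration has no points
in a thin enough shell and is eventually unchanged. -/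
theorem basisApprox_of_isOpen (hR : 0 < R) {Y : Ξ → OutConfig (Metric.ball c R)}
    (hY : Measurable Y) (hg : ∀ᵐ ξ ∂P, IsGeneric c R (Y ξ).1.points)
    {U : Set (OutConfig (Metric.ball c R))} (hU : IsOpen U) : BasisApprox c P Y U := by
  obtain ⟨U', hU', rfl⟩ := isOpen_induced_iff.1 hU
  have hr : ∀ k : ℕ, ∃ r : ℚ, R < r ∧ (r : ℝ) < R + 1 / (k + 1) := fun k =>
    exists_rat_btwn (by
      have : (0 : ℝ) < 1 / (k + 1) := Nat.one_div_pos_of_nat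
      linarith)
  choose r hr1 hr2 using hr
  have hrt : Tendsto (fun k => (r k : ℝ)) atTop (𝓝[>] R) := by
    refine tendsto_nhdsWithin_iff.2 ⟨?_, Eventually.of_forall hr1⟩
    refine tendsto_of_tendsto_of_tendsto_of_le_of_le tendsto_const_nhds ?_ (fun k => (hr1 k).le)
      fun k => (hr2 k).le
    simpa using tendsto_const_nhds.add (tendsto_one_div_add_atTop_nhds_zero_nat (𝕜 := ℝ))
  have hVm : ∀ k, MeasurableSet {Υ : OutConfig (Metric.ball c R) |
      (Υ.1.out (Metric.ball c (r k))).1 ∈ U'} := fun k =>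
    (measurable_subtype_coe.comp ((Config.measurable_out Metric.isOpen_ball).comp
      measurable_subtype_coe)) hU'.measurableSet
  refine BasisApprox.of_ae_eventually hY hU.measurableSet hVm (fun k => ?_) ?_
  · refine BasisApprox.of_ae_exists_mem hY (hVm k) ?_
    filter_upwards [hg] with ξ hξ h
    exact hξ.exists_mem_outBasis_of_out_mem (by exact_mod_cast hR.trans (hr1 k)) (hr1 k).le hU' h
  · filter_upwards [hg] with ξ hξ
    filter_upwards [hrt.eventually (eventually_out_ball_eq hξ.1)] with k hk
    simp only [hk, mem_preimage]

/-- A generic configuration outside a finite union of basis sets has a basis set around it that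
misses the union, so the complement of the union is again approximable. -/
theorem BasisApprox.compl {Y : Ξ → OutConfig (Metric.ball c R)}
    (hY : Measurable Y) (hg : ∀ᵐ ξ ∂P, IsGeneric c R (Y ξ).1.points)
    {U : Set (OutConfig (Metric.ball c R))} (hU : BasisApprox c P Y U) : BasisApprox c P Y Uᶜ := by
  refine BasisApprox.of_forall_exists fun ε hε => ?_
  obtain ⟨F, hF, hFb, h⟩ := hU ε hε
  refine ⟨(⋃₀ F)ᶜ, ?_, ?_⟩
  · refine BasisApprox.of_ae_exists_mem hY (MeasurableSet.sUnion hF.countable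
      fun B hB => measurableSet_of_mem_outBasis (hFb hB)).compl ?_
    filter_upwards [hg] with ξ hξ hmem
    obtain ⟨G, hG, hGm, hGF⟩ := hξ.exists_mem_outBasis_forall_iff hF hFb
    refine ⟨G, hG, hGm, ?_⟩
    rintro Υ' hΥ' ⟨B, hB, hBm⟩
    exact hmem ⟨B, hB, (hGF Υ' hΥ' B hB).1 hBm⟩
  · rwa [preimage_compl, preimage_compl, compl_symmDiff_compl]

theorem basisApprox_of_measurableSet (hR : 0 < R) {Y : Ξ → OutConfig (Metric.ball c R)}
    (hY : Measurable Y) (hg : ∀ᵐ ξ ∂P, IsGeneric c R (Y ξ).1.points)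
    {U : Set (OutConfig (Metric.ball c R))} (hU : MeasurableSet U) : BasisApprox c P Y U := by
  induction U, hU using MeasurableSet.induction_on_open with
  | isOpen U hU => exact basisApprox_of_isOpen hR hY hg hU
  | compl U _ ih => exact ih.compl hY hg
  | iUnion f _ hf ih => exact BasisApprox.iUnion hY hf ih

end Approx

/-! ### Passage to the limit in the comparison. -/

theorem IsGeneric.eventually_out_mem_sUnion_iff {d : ℕ} {c : EuclideanSpace ℝ (Fin d)} {R : ℝ}
    {Υ : Config (EuclideanSpace ℝ (Fin d))} (hg : IsGeneric c R Υ.points)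
    {F : Set (Set (OutConfig (Metric.ball c R)))} (hF : F.Finite)
    (hFb : F ⊆ outBasis (Metric.ball c R) c) :
    ∀ᶠ Υ' in 𝓝 Υ, (Υ'.out (Metric.ball c R) ∈ ⋃₀ F ↔ Υ.out (Metric.ball c R) ∈ ⋃₀ F) := by
  have hcount : ∀ K : Set (EuclideanSpace ℝ (Fin d)), Bornology.IsBounded K →
      Disjoint Υ.points (frontier K) → ∀ᶠ Υ' in 𝓝 Υ,
        ((Υ'.out (Metric.ball c R)).1.points ∩ K).encard =
          ((Υ.out (Metric.ball c R)).1.points ∩ K).encard := by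
    intro K hb hK
    simp only [Config.out_inter_eq]
    refine Υ.eventually_encard_inter_eq (hb.subset sdiff_subset) ?_
    refine (hK.union_right hg.1).mono_right ?_
    rw [sdiff_eq]
    refine (frontier_inter_subset _ _).trans (union_subset_union inter_subset_left ?_)
    rw [frontier_compl]
    exact inter_subset_right.trans Metric.frontier_ball_subset_sphere
  have hB : ∀ B ∈ F, ∀ᶠ Υ' in 𝓝 Υ,
      (Υ'.out (Metric.ball c R) ∈ B ↔ Υ.out (Metric.ball c R) ∈ B) := by
    intro B hB
    obtain ⟨n, r, s, q, t, hr, hrs, -, hqt, -, -, rfl⟩ := hFb hB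
    filter_upwards [hcount _ (isCompact_closedAnnulus r s).isBounded
      (hg.disjoint_frontier_closedAnnulus hr hrs), eventually_all.2 fun i =>
        hcount _ Metric.isBounded_ball (hg.disjoint_frontier_ball (hqt i).1 (hqt i).2)]
      with Υ' h1 h2
    simp only [h1, h2]
  filter_upwards [(eventually_all_finite hF).2 hB] with Υ' h
  simp only [mem_sUnion]
  exact exists_congr fun B => and_congr_right fun hBF => h B hBF

theorem ENNReal.eventually_toReal_le_add_of_le_liminf {a : ℝ≥0∞} {b : ℕ → ℝ≥0∞}
    (hb : ∀ k, b k ≠ ∞) (h : a ≤ liminf b atTop) (ha : a ≠ ∞) {ε : ℝ} (hε : 0 < ε) :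
    ∀ᶠ k in atTop, a.toReal ≤ (b k).toReal + ε := by
  rcases eq_or_ne a 0 with rfl | h0
  · refine Eventually.of_forall fun k => ?_
    rw [ENNReal.toReal_zero]
    positivity
  · have hlt : a - ENNReal.ofReal ε < liminf b atTop :=
      (ENNReal.sub_lt_self ha h0 (ENNReal.ofReal_pos.2 hε).ne').trans_le h
    filter_upwards [eventually_lt_of_lt_liminf hlt] with k hk
    have h1 := tsub_le_iff_right.1 hk.le
    have h2 := ENNReal.toReal_mono (by simp [hb k]) h1
    rwa [ENNReal.toReal_add (hb k) ENNReal.ofReal_ne_top, ENNReal.toReal_ofReal hε.le] at h2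

section Comparison

variable {Ξ : Type*} [MeasurableSpace Ξ] {P : Measure Ξ} [IsFiniteMeasure P]

theorem measureReal_le_add_of_subset {A B C : Set Ξ} (h : A ⊆ B ∪ C) :
    P.real A ≤ P.real B + P.real C :=
  (measureReal_mono h).trans (measureReal_union_le _ _)

theorem setIntegral_le_add_measureReal_sdiff {g : Ξ → ℝ} (hg : Measurable g)
    (h0 : ∀ ξ, 0 ≤ g ξ) (h1 : ∀ ξ, g ξ ≤ 1) {S T : Set Ξ}
    (hT : MeasurableSet T) : ∫ ξ in S, g ξ ∂P ≤ ∫ ξ in T, g ξ ∂P + P.real (S \ T) := by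
  have hi : Integrable g P := by
    refine Integrable.of_bound hg.aestronglyMeasurable 1 (Eventually.of_forall fun ξ => ?_)
    rw [Real.norm_eq_abs, abs_of_nonneg (h0 ξ)]
    exact h1 ξ
  rw [← integral_inter_add_sdiff (s := S) hT hi.integrableOn]
  refine add_le_add ?_ ?_
  · exact setIntegral_mono_set hi.integrableOn (Eventually.of_forall h0)
      (Eventually.of_forall fun ξ h => h.2)
  · calc ∫ ξ in S \ T, g ξ ∂P ≤ ∫ _ in S \ T, (1 : ℝ) ∂P :=
          setIntegral_mono hi.integrableOn (integrable_const _).integrableOn h1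
      _ = P.real (S \ T) := by simp

/-- Passage to the limit in a two-sided comparison. As the law of `ζ` may charge the boundary of
`A`, the upper bound is in terms of the closure. -/
theorem comparison_limit {d m : ℕ} {c : EuclideanSpace ℝ (Fin d)} {R : ℝ} (hR : 0 < R)
    {X : Ξ → Config (EuclideanSpace ℝ (Fin d))} {Xn : ℕ → Ξ → Config (EuclideanSpace ℝ (Fin d))}
    (hX : Measurable X) (hXn : ∀ n, Measurable (Xn n))
    (hlim : ∀ᵐ ξ ∂P, Tendsto (fun n => Xn n ξ) atTop (𝓝 (X ξ)))
    (hgen : ∀ᵐ ξ ∂P, IsGeneric c R (X ξ).points)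
    {ζ : Ξ → VarVec (Metric.ball c R)} {ζn : ℕ → Ξ → VarVec (Metric.ball c R)}
    (hζ : IsUniformOrdering P (Metric.ball c R) X ζ)
    (hζn : ∀ n, IsUniformOrdering P (Metric.ball c R) (Xn n) (ζn n))
    {W : Set Ξ} (hW : MeasurableSet W) {Ωn : ℕ → Set Ξ} (hΩn : ∀ n, MeasurableSet (Ωn n))
    {U : Set (OutConfig (Metric.ball c R))} (hU : MeasurableSet U)
    (hUW : (fun ξ => (X ξ).out (Metric.ball c R)) ⁻¹' U ⊆ W)
    (hUΩ : ∀ ξ, (X ξ).out (Metric.ball c R) ∈ U → ∀ᶠ n in atTop, ξ ∈ Ωn n)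
    {g : Ξ → ℝ} (hg : Measurable g) (hg0 : ∀ ξ, 0 ≤ g ξ) (hg1 : ∀ ξ, g ξ ≤ 1)
    {A : Set (Fin m → Metric.ball c R)} (hA : IsOpen A) {k₁ k₂ : ℝ} (hk₁ : 0 < k₁) (hk₂ : 0 < k₂)
    (hcomp : ∀ B ∈ finiteUnions (outBasis (Metric.ball c R) c),
      ∃ ϑ : ℕ → ℝ, Tendsto ϑ atTop (𝓝 0) ∧ ∀ k,
        k₁ * P.real ({ξ | ζn k ξ ∈ Sigma.mk m '' A} ∩
            {ξ | (Xn k ξ).out (Metric.ball c R) ∈ B} ∩ Ωn k) ≤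
          (∫ ξ in {ξ | (Xn k ξ).out (Metric.ball c R) ∈ B} ∩ Ωn k ∩ W, g ξ ∂P) + ϑ k ∧
        (∫ ξ in {ξ | (Xn k ξ).out (Metric.ball c R) ∈ B} ∩ Ωn k ∩ W, g ξ ∂P) + ϑ k ≤
          k₂ * P.real ({ξ | ζn k ξ ∈ Sigma.mk m '' A} ∩
            {ξ | (Xn k ξ).out (Metric.ball c R) ∈ B} ∩ Ωn k)) :
    k₁ * P.real ((fun ξ => (X ξ).out (Metric.ball c R)) ⁻¹' U ∩ ζ ⁻¹' (Sigma.mk m '' A)) ≤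
      ∫ ξ in (fun ξ => (X ξ).out (Metric.ball c R)) ⁻¹' U, g ξ ∂P ∧
    ∫ ξ in (fun ξ => (X ξ).out (Metric.ball c R)) ⁻¹' U, g ξ ∂P ≤
      k₂ * P.real ((fun ξ => (X ξ).out (Metric.ball c R)) ⁻¹' U ∩
        ζ ⁻¹' (Sigma.mk m '' closure A)) := by
  have hDo : IsOpen (Metric.ball c R) := Metric.isOpen_ball
  have hDb : Bornology.IsBounded (Metric.ball c R) := Metric.isBounded_ball
  have hout : Measurable (Config.out (Metric.ball c R)) :=
    Config.measurable_out hDo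
  set S : Set Ξ := (fun ξ => (X ξ).out (Metric.ball c R)) ⁻¹' U with hS
  have hSm : MeasurableSet S := (hout.comp hX) hU
  have hgenY : ∀ᵐ ξ ∂P, IsGeneric c R ((X ξ).out (Metric.ball c R)).1.points := by
    filter_upwards [hgen] with ξ h
    exact h.mono sdiff_subset
  have hAo : IsOpen (Sigma.mk m '' A : Set (VarVec (Metric.ball c R))) := isOpenMap_sigmaMk _ hA
  have hCo : IsOpen (Sigma.mk m '' closure A : Set (VarVec (Metric.ball c R)))ᶜ :=
    (isClosedMap_sigmaMk _ isClosed_closure).isOpen_compl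
  -- The errors found below are `(3 + 5 * k₁) * ε` for the lower and `(4 + 3 * k₂) * ε` for the
  -- upper bound; one constant serves for both.
  suffices key : ∀ ε : ℝ, 0 < ε →
      k₁ * P.real (S ∩ ζ ⁻¹' (Sigma.mk m '' A)) ≤ ∫ ξ in S, g ξ ∂P + (4 + 5 * k₁ + 3 * k₂) * ε ∧
      ∫ ξ in S, g ξ ∂P ≤ k₂ * P.real (S ∩ ζ ⁻¹' (Sigma.mk m '' closure A)) +
        (4 + 5 * k₁ + 3 * k₂) * ε by
    have hpos : 0 < 4 + 5 * k₁ + 3 * k₂ := by positivity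
    constructor <;> refine le_of_forall_pos_le_add fun ε hε => ?_
    · simpa [mul_div_cancel₀ _ hpos.ne'] using (key (ε / (4 + 5 * k₁ + 3 * k₂)) (by positivity)).1
    · simpa [mul_div_cancel₀ _ hpos.ne'] using (key (ε / (4 + 5 * k₁ + 3 * k₂)) (by positivity)).2
  intro ε hε
  obtain ⟨F, hF, hFb, hSF⟩ := basisApprox_of_measurableSet hR (hout.comp hX) hgenY hU
    (ENNReal.ofReal ε) (ENNReal.ofReal_pos.2 hε).ne'
  have hSF' : P.real (symmDiff S ((fun ξ => (X ξ).out (Metric.ball c R)) ⁻¹' ⋃₀ F)) ≤ ε :=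
    ENNReal.toReal_le_of_le_ofReal hε.le hSF
  -- The comparison is assumed for non-empty unions only. An empty approximating family forces
  -- `P.real S ≤ ε`, and both bounds are then trivial.
  rcases F.eq_empty_or_nonempty with rfl | hFne
  · have hSε : P.real S ≤ ε := by simpa [symmDiff_def] using hSF'
    have h1 : P.real (S ∩ ζ ⁻¹' (Sigma.mk m '' A)) ≤ ε :=
      (measureReal_mono inter_subset_left).trans hSε
    have h2 : 0 ≤ ∫ ξ in S, g ξ ∂P := integral_nonneg hg0
    have h3 := setIntegral_le_add_measureReal_sdiff (P := P) hg hg0 hg1 (S := S)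
      MeasurableSet.empty
    have h4 : 0 ≤ P.real (S ∩ ζ ⁻¹' (Sigma.mk m '' closure A)) := measureReal_nonneg
    simp only [setIntegral_empty, sdiff_empty, zero_add] at h3
    constructor
    · nlinarith
    · nlinarith [mul_nonneg hk₂.le h4]
  set C : Set (Config (EuclideanSpace ℝ (Fin d))) := Config.out (Metric.ball c R) ⁻¹' ⋃₀ F with hC
  have hCm : MeasurableSet C := hout (MeasurableSet.sUnion hF.countable
    fun B hB => measurableSet_of_mem_outBasis (hFb hB))
  have hCev : ∀ᵐ ξ ∂P, ∀ᶠ n in atTop, (Xn n ξ ∈ C ↔ X ξ ∈ C) := by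
    filter_upwards [hlim, hgen] with ξ h1 h2
    exact h1.eventually (h2.eventually_out_mem_sUnion_iff hF hFb)
  have hfr : ∀ᵐ ξ ∂P, Disjoint (X ξ).points (frontier (Metric.ball c R)) := by
    filter_upwards [hgen] with ξ h
    exact h.1.mono_right Metric.frontier_ball_subset_sphere
  obtain ⟨ϑ, hϑ, hϑk⟩ := hcomp (⋃₀ F) ⟨F, hF, hFne, hFb, rfl⟩
  have hT : Tendsto (fun k => P (symmDiff (X ⁻¹' C) (Xn k ⁻¹' C))) atTop (𝓝 0) := by
    refine tendsto_measure_zero_of_ae_eventually_notMem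
      (fun k => (hX hCm).symmDiff (hXn k hCm)) ?_
    filter_upwards [hCev] with ξ hξ
    filter_upwards [hξ] with k hk
    simp [Set.mem_symmDiff, hk]
  have hSΩ : Tendsto (fun k => P (S \ Ωn k)) atTop (𝓝 0) := by
    refine tendsto_measure_zero_of_ae_eventually_notMem (fun k => hSm.diff (hΩn k))
      (Eventually.of_forall fun ξ => ?_)
    by_cases h : ξ ∈ S
    · filter_upwards [hUΩ ξ h] with k hk h'
      exact h'.2 hk
    · exact Eventually.of_forall fun k h' => h h'.1
  have hreal : ∀ {s : ℕ → Set Ξ}, Tendsto (fun k => P (s k)) atTop (𝓝 0) →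
      ∀ᶠ k in atTop, P.real (s k) ≤ ε := by
    intro s hs
    filter_upwards [hs.eventually (gt_mem_nhds (ENNReal.ofReal_pos.2 hε))] with k hk
    exact ENNReal.toReal_le_of_le_ofReal hε.le hk.le
  have hlow : ∀ {O : Set (VarVec (Metric.ball c R))}, IsOpen O → ∀ᶠ k in atTop,
      P.real (X ⁻¹' C ∩ ζ ⁻¹' O) ≤ P.real (Xn k ⁻¹' C ∩ ζn k ⁻¹' O) + ε := fun hO =>
    ENNReal.eventually_toReal_le_add_of_le_liminf (fun k => measure_ne_top _ _)
      (IsUniformOrdering.measure_le_liminf hDo hDb hX hXn hlim hfr hζ hζn hCm hCev hO)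
      (measure_ne_top _ _) hε
  obtain ⟨k, e1, e2, e3, e4, e5⟩ := ((hreal hT).and ((hreal hSΩ).and ((hlow hAo).and
    ((hlow hCo).and (hϑ.eventually (Metric.ball_mem_nhds 0 hε)))))).exists
  rw [Real.dist_0_eq_abs, abs_lt] at e5
  obtain ⟨f1, f2⟩ := hϑk k
  set T : Set Ξ := X ⁻¹' C with hTdef
  set Tk : Set Ξ := Xn k ⁻¹' C with hTk
  have e0 : P.real (symmDiff S T) ≤ ε := hSF'
  have hTm : MeasurableSet T := hX hCm
  have hTkm : MeasurableSet Tk := hXn k hCm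
  change k₁ * P.real (ζn k ⁻¹' (Sigma.mk m '' A) ∩ Tk ∩ Ωn k) ≤
    (∫ ξ in Tk ∩ Ωn k ∩ W, g ξ ∂P) + ϑ k at f1
  change (∫ ξ in Tk ∩ Ωn k ∩ W, g ξ ∂P) + ϑ k ≤
    k₂ * P.real (ζn k ⁻¹' (Sigma.mk m '' A) ∩ Tk ∩ Ωn k) at f2
  have hSkm : MeasurableSet (Tk ∩ Ωn k ∩ W) := (hTkm.inter (hΩn k)).inter hW
  have g1 := setIntegral_le_add_measureReal_sdiff (P := P) hg hg0 hg1 (S := S) hSkm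
  have g2 := setIntegral_le_add_measureReal_sdiff (P := P) hg hg0 hg1 (S := Tk ∩ Ωn k ∩ W) hSm
  have a1 : P.real (S \ (Tk ∩ Ωn k ∩ W)) ≤
      P.real (symmDiff S T ∪ symmDiff T Tk) + P.real (S \ Ωn k) := by
    refine measureReal_le_add_of_subset fun ξ hξ => ?_
    have hξW := hUW hξ.1
    simp only [Set.mem_sdiff, Set.mem_inter_iff, Set.mem_union, Set.mem_symmDiff] at hξ ⊢
    tauto
  have a2 : P.real ((Tk ∩ Ωn k ∩ W) \ S) ≤ P.real (symmDiff S T) + P.real (symmDiff T Tk) := by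
    refine measureReal_le_add_of_subset fun ξ hξ => ?_
    simp only [Set.mem_sdiff, Set.mem_inter_iff, Set.mem_union, Set.mem_symmDiff] at hξ ⊢
    tauto
  have a3 : P.real (symmDiff S T ∪ symmDiff T Tk) ≤ _ := measureReal_union_le _ _
  have a4 : P.real (S ∩ ζ ⁻¹' (Sigma.mk m '' A)) ≤
      P.real (T ∩ ζ ⁻¹' (Sigma.mk m '' A)) + P.real (symmDiff S T) := by
    refine measureReal_le_add_of_subset fun ξ hξ => ?_
    simp only [Set.mem_inter_iff, Set.mem_union, Set.mem_symmDiff] at hξ ⊢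
    tauto
  -- Restricting to `Ωn k` loses little: `Tk` is close to `S`, and almost all of `S` lies in `Ωn k`
  -- for large `k`.
  have a5 : P.real (Tk ∩ ζn k ⁻¹' (Sigma.mk m '' A)) ≤
      P.real (ζn k ⁻¹' (Sigma.mk m '' A) ∩ Tk ∩ Ωn k) + P.real (Tk \ Ωn k) := by
    refine measureReal_le_add_of_subset fun ξ hξ => ?_
    simp only [Set.mem_inter_iff, Set.mem_union, Set.mem_sdiff] at hξ ⊢
    tauto
  have a6 : P.real (Tk \ Ωn k) ≤
      P.real (symmDiff S T ∪ symmDiff T Tk) + P.real (S \ Ωn k) := by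
    refine measureReal_le_add_of_subset fun ξ hξ => ?_
    simp only [Set.mem_sdiff, Set.mem_union, Set.mem_symmDiff] at hξ ⊢
    tauto
  have hζm : ∀ {O : Set (VarVec (Metric.ball c R))}, IsOpen O → MeasurableSet (ζ ⁻¹' O) := fun hO =>
    hζ.measurable (VarVec.measurableSet_of_isOpen hO)
  have hζkm : ∀ {O : Set (VarVec (Metric.ball c R))}, IsOpen O → MeasurableSet (ζn k ⁻¹' O) :=
    fun hO =>
    (hζn k).measurable (VarVec.measurableSet_of_isOpen hO)
  -- For the upper bound the semicontinuity is applied to the open complement of the closure, and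
  -- complements are taken within `T` and `Tk`.
  have b1 := measureReal_inter_add_sdiff (μ := P) (s := T) (hζm hCo)
  have b2 := measureReal_inter_add_sdiff (μ := P) (s := Tk) (hζkm hCo)
  have b3 : P.real (ζn k ⁻¹' (Sigma.mk m '' A) ∩ Tk ∩ Ωn k) ≤
      P.real (Tk \ ζn k ⁻¹' (Sigma.mk m '' closure A)ᶜ) :=
    measureReal_mono fun ξ hξ => ⟨hξ.1.2, fun h => h (image_mono subset_closure hξ.1.1)⟩
  have b4 : P.real (T \ ζ ⁻¹' (Sigma.mk m '' closure A)ᶜ) ≤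
      P.real (S ∩ ζ ⁻¹' (Sigma.mk m '' closure A)) + P.real (symmDiff S T) := by
    refine measureReal_le_add_of_subset fun ξ hξ => ?_
    simp only [Set.mem_sdiff, Set.mem_inter_iff, Set.mem_union, Set.mem_symmDiff, mem_preimage,
      mem_compl_iff, not_not] at hξ ⊢
    tauto
  have b5 : P.real Tk ≤ P.real T + P.real (symmDiff T Tk) := by
    refine measureReal_le_add_of_subset fun ξ hξ => ?_
    simp only [Set.mem_union, Set.mem_symmDiff]
    tauto
  constructor
  · have h1 : P.real (S ∩ ζ ⁻¹' (Sigma.mk m '' A)) ≤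
        P.real (ζn k ⁻¹' (Sigma.mk m '' A) ∩ Tk ∩ Ωn k) + 5 * ε := by linarith
    have h2 := mul_le_mul_of_nonneg_left h1 hk₁.le
    have h3 := mul_pos hk₂ hε
    nlinarith
  · have h1 : P.real (ζn k ⁻¹' (Sigma.mk m '' A) ∩ Tk ∩ Ωn k) ≤
        P.real (S ∩ ζ ⁻¹' (Sigma.mk m '' closure A)) + 3 * ε := by linarith
    have h2 := mul_le_mul_of_nonneg_left h1 hk₂.le
    have h3 := mul_pos hk₁ hε
    nlinarith

end Comparison

/-! ### From finite unions of balls to Borel sets in `Dᵐ`. -/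

section InBasis

variable {d m : ℕ} {D : Set (EuclideanSpace ℝ (Fin d))}

theorem isOpen_of_mem_inBasis {A : Set (Fin m → D)} (hA : A ∈ inBasis D m) : IsOpen A := by
  obtain ⟨q, r, -, -, -, rfl⟩ := hA
  have h : Continuous fun x : Fin m → D => ∑ i, ‖(x i : EuclideanSpace ℝ (Fin d)) - q i‖ ^ 2 := by
    refine continuous_finsetSum _ fun i _ => ?_
    fun_prop
  exact isOpen_lt h continuous_const

theorem isOpen_of_mem_finiteUnions {A : Set (Fin m → D)} (hA : A ∈ finiteUnions (inBasis D m)) :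
    IsOpen A := by
  obtain ⟨F, -, -, hF, rfl⟩ := hA
  exact isOpen_sUnion fun B hB => isOpen_of_mem_inBasis (hF hB)

theorem countable_inBasis : (inBasis D m).Countable := by
  let f : (Fin m → Fin d → ℚ) × ℚ → Set (Fin m → D) := fun a =>
    {x | (fun i => (x i : EuclideanSpace ℝ (Fin d))) ∈ vecBall (fun i => ratPoint (a.1 i)) a.2}
  refine (countable_range f).mono ?_
  rintro A ⟨q, r, hq, -, -, rfl⟩
  choose k hk using fun i => (hq i).mem_range
  exact ⟨⟨k, r⟩, by simp only [f, hk]⟩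

theorem countable_finiteUnions {α : Type*} {𝒞 : Set (Set α)} (h : 𝒞.Countable) :
    (finiteUnions 𝒞).Countable := by
  refine ((countable_ofPred_finite_subset h).image sUnion).mono ?_
  rintro A ⟨F, hF, -, hFc, rfl⟩
  exact ⟨F, ⟨hF, hFc⟩, rfl⟩

theorem norm_sub_lt_of_mem_vecBall {q x : Fin m → EuclideanSpace ℝ (Fin d)} {r : ℝ} (hr : 0 < r)
    (hx : x ∈ vecBall q r) (i : Fin m) : ‖x i - q i‖ < r := by
  refine lt_of_pow_lt_pow_left₀ 2 hr.le (lt_of_le_of_lt ?_ hx)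
  exact Finset.single_le_sum (f := fun i => ‖x i - q i‖ ^ 2) (fun _ _ => sq_nonneg _)
    (Finset.mem_univ i)

theorem exists_mem_inBasis_closure_subset (hD : IsOpen D) {O : Set (Fin m → D)} (hO : IsOpen O)
    {x : Fin m → D} (hx : x ∈ O) : ∃ A ∈ inBasis D m, x ∈ A ∧ closure A ⊆ O := by
  obtain ⟨ε, hε, hεO⟩ := Metric.isOpen_iff.1 hO x hx
  have hDev : ∀ᶠ y in 𝓝 fun i => (x i : EuclideanSpace ℝ (Fin d)), ∀ i, y i ∈ D := by
    rw [eventually_all]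
    exact fun i => (continuous_apply i).continuousAt.preimage_mem_nhds (hD.mem_nhds (x i).2)
  obtain ⟨δ, hδ, hδD⟩ := Metric.eventually_nhds_iff.1 hDev
  -- A Euclidean ball of radius `r` containing `x` lies within `2 * r` of `x` in each coordinate.
  -- This keeps the ball in `Dᵐ` and its closure in `O`.
  obtain ⟨r, hr0, hr⟩ := exists_rat_btwn (show (0 : ℝ) < min ε δ / 2 by positivity)
  have hrε : 2 * (r : ℝ) < ε := by linarith [min_le_left ε δ]
  have hrδ : 2 * (r : ℝ) < δ := by linarith [min_le_right ε δ]
  obtain ⟨k, hk⟩ : ∃ k : Fin m → Fin d → ℚ, ∑ i, ‖(x i : EuclideanSpace ℝ (Fin d)) -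
      ratPoint (k i)‖ ^ 2 < (r : ℝ) ^ 2 := by
    have hdense : DenseRange (Pi.map fun (_ : Fin m) => ratPoint (d := d)) :=
      DenseRange.piMap fun _ => denseRange_ratPoint
    have hc : Continuous fun y : Fin m → EuclideanSpace ℝ (Fin d) =>
        ∑ i, ‖(x i : EuclideanSpace ℝ (Fin d)) - y i‖ ^ 2 := by
      refine continuous_finsetSum _ fun i _ => ?_
      fun_prop
    refine hdense.exists_mem_open (isOpen_lt hc continuous_const)
      ⟨fun i => (x i : EuclideanSpace ℝ (Fin d)), ?_⟩
    simpa using pow_pos hr0 2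
  have hxk : (fun i => (x i : EuclideanSpace ℝ (Fin d))) ∈ vecBall (fun i => ratPoint (k i)) r := hk
  have hdist : ∀ y ∈ vecBall (fun i => ratPoint (k i)) (r : ℝ), ∀ i,
      dist (y i) (x i : EuclideanSpace ℝ (Fin d)) < 2 * r := by
    intro y hy i
    have h1 := norm_sub_lt_of_mem_vecBall hr0 hy i
    have h2 := norm_sub_lt_of_mem_vecBall hr0 hxk i
    rw [← dist_eq_norm] at h1 h2
    have h3 := dist_triangle_right (y i) (x i : EuclideanSpace ℝ (Fin d)) (ratPoint (k i))
    linarith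
  refine ⟨_, ⟨fun i => ratPoint (k i), r, fun i => isRationalPoint_ratPoint _,
    by exact_mod_cast hr0, fun y hy => ?_, rfl⟩, hxk, ?_⟩
  · exact hδD ((dist_pi_lt_iff hδ).2 fun i => (hdist y hy i).trans hrδ)
  · refine (closure_minimal (t := Metric.closedBall x (2 * r)) ?_ Metric.isClosed_closedBall).trans
      ((Metric.closedBall_subset_ball hrε).trans hεO)
    intro y hy
    exact Metric.mem_closedBall.2 ((dist_pi_le_iff (by positivity)).2 fun i => (hdist _ hy i).le)

/-- Countably many basis balls with closure in `O` cover `O`. Their partial unions increase to `O`,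
and the closure of a finite union stays inside. -/
theorem measure_isOpen_le_of_forall_finiteUnions (hD : IsOpen D) (α : Measure (Fin m → D))
    {O : Set (Fin m → D)} (hO : IsOpen O) {b : ℝ≥0∞}
    (h : ∀ A ∈ finiteUnions (inBasis D m), closure A ⊆ O → α A ≤ b) : α O ≤ b := by
  set 𝒢 : Set (Set (Fin m → D)) := {A | A ∈ inBasis D m ∧ closure A ⊆ O} with h𝒢
  have hOeq : O = ⋃₀ 𝒢 := by
    apply Subset.antisymm
    · intro x hx
      obtain ⟨A, hA, hxA, hAO⟩ := exists_mem_inBasis_closure_subset hD hO hx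
      exact ⟨A, ⟨hA, hAO⟩, hxA⟩
    · exact sUnion_subset fun A hA => subset_closure.trans hA.2
  rcases 𝒢.eq_empty_or_nonempty with h0 | hne
  · rw [hOeq, h0]
    simp
  · obtain ⟨f, hf⟩ := (countable_inBasis.mono fun A hA => hA.1 : 𝒢.Countable).exists_eq_range hne
    have hf𝒢 : ∀ n, f n ∈ 𝒢 := fun n => hf ▸ mem_range_self n
    have hacc : ∀ n, accumulate f n = ⋃₀ (f '' Iic n) := fun n => by
      rw [sUnion_image, accumulate_def]
      rfl
    rw [hOeq, hf, sUnion_range, measure_iUnion_eq_iSup_accumulate]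
    refine iSup_le fun n => ?_
    rw [hacc]
    refine h _ ⟨f '' Iic n, (finite_Iic n).image f, ⟨f n, n, self_mem_Iic, rfl⟩, ?_, rfl⟩ ?_
    · rintro _ ⟨i, -, rfl⟩
      exact (hf𝒢 i).1
    · rw [((finite_Iic n).image f).closure_sUnion]
      refine iUnion₂_subset ?_
      rintro _ ⟨i, -, rfl⟩
      exact (hf𝒢 i).2

end InBasis

theorem MeasureTheory.Measure.le_of_forall_isOpen {α : Type*} [TopologicalSpace α]
    [MeasurableSpace α] {μ ν : Measure α} [ν.OuterRegular] (h : ∀ O, IsOpen O → μ O ≤ ν O)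
    (s : Set α) : μ s ≤ ν s := by
  rw [s.measure_eq_iInf_isOpen ν]
  exact le_iInf₂ fun O hsO => le_iInf fun hO => (measure_mono hsO).trans (h O hO)

/-- Bounds on finite unions of basis sets, with the closure on one side, extend to all Borel
sets. -/
theorem measure_bounds_of_finiteUnions {d m : ℕ} {D : Set (EuclideanSpace ℝ (Fin d))}
    (hD : IsOpen D) (α β : Measure (Fin m → D)) [IsFiniteMeasure α] [IsFiniteMeasure β] {a b : ℝ≥0}
    (h₁ : ∀ A ∈ finiteUnions (inBasis D m), a * β A ≤ α A)
    (h₂ : ∀ A ∈ finiteUnions (inBasis D m), α A ≤ b * β (closure A)) (A : Set (Fin m → D)) :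
    a * β A ≤ α A ∧ α A ≤ b * β A := by
  constructor
  · refine Measure.le_of_forall_isOpen (μ := a • β) (ν := α) (fun O hO => ?_) A
    exact measure_isOpen_le_of_forall_finiteUnions hD (a • β) hO fun B hB hBO =>
      (h₁ B hB).trans (measure_mono (subset_closure.trans hBO))
  · refine Measure.le_of_forall_isOpen (μ := α) (ν := b • β) (fun O hO => ?_) A
    refine measure_isOpen_le_of_forall_finiteUnions hD α hO fun B hB hBO => ?_
    refine (h₂ B hB).trans ?_
    change b * β (closure B) ≤ b * β O
    gcongr

/-! ### Disintegration, and factorisation through the outside configuration. -/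

section Disintegration

variable {Ξ T V : Type*} [MeasurableSpace Ξ] [MeasurableSpace T] [MeasurableSpace V]
  {P : Measure Ξ} [IsFiniteMeasure P] {Y : Ξ → T} {Z : Ξ → V} {γ : Kernel T V}

/-- By disintegration the hypothesis compares the integrals of two densities over every measurable
subset of `V₀`, which orders the densities almost everywhere there. -/
theorem IsRegularCondDistrib.ae_bounds (hγ : IsRegularCondDistrib P Y Z γ) (hY : Measurable Y)
    {V₀ : Set T} (hV₀ : MeasurableSet V₀) {g : T → ℝ} (hg : Measurable g) (hg0 : ∀ t, 0 ≤ g t)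
    (hg1 : ∀ t, g t ≤ 1) {A C : Set V} (hA : MeasurableSet A) (hC : MeasurableSet C) {a b : ℝ≥0}
    (h : ∀ U, MeasurableSet U → U ⊆ V₀ →
      a * P.real (Y ⁻¹' U ∩ Z ⁻¹' A) ≤ ∫ ξ in Y ⁻¹' U, g (Y ξ) ∂P ∧
      ∫ ξ in Y ⁻¹' U, g (Y ξ) ∂P ≤ b * P.real (Y ⁻¹' U ∩ Z ⁻¹' C)) :
    ∀ᵐ ξ ∂P, Y ξ ∈ V₀ →
      a * γ (Y ξ) A ≤ ENNReal.ofReal (g (Y ξ)) ∧ ENNReal.ofReal (g (Y ξ)) ≤ b * γ (Y ξ) C := by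
  have : IsFiniteMeasure (P.map Y) := Measure.isFiniteMeasure_map P Y
  have hgi : Integrable (fun ξ => g (Y ξ)) P := by
    refine Integrable.of_bound (hg.comp hY).aestronglyMeasurable 1
      (Eventually.of_forall fun ξ => ?_)
    rw [Real.norm_eq_abs, abs_of_nonneg (hg0 _)]
    exact hg1 _
  have hgint : ∀ U, MeasurableSet U → ENNReal.ofReal (∫ ξ in Y ⁻¹' U, g (Y ξ) ∂P) =
      ∫⁻ t in U, ENNReal.ofReal (g t) ∂(P.map Y) := by
    intro U hU
    rw [ofReal_integral_eq_lintegral_ofReal hgi.integrableOn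
      (Eventually.of_forall fun ξ => hg0 _), setLIntegral_map hU hg.ennreal_ofReal hY]
  have hγint : ∀ (k : ℝ≥0) (B : Set V) (U), MeasurableSet B → MeasurableSet U →
      ENNReal.ofReal (k * P.real (Y ⁻¹' U ∩ Z ⁻¹' B)) = ∫⁻ t in U, k * γ t B ∂(P.map Y) := by
    intro k B U hB hU
    rw [lintegral_const_mul _ (γ.measurable_coe hB), ← hγ.disintegration U B hU hB,
      ENNReal.ofReal_mul k.coe_nonneg, ENNReal.ofReal_coe_nnreal, ofReal_measureReal]
  have hae : ∀ {f₁ f₂ : T → ℝ≥0∞}, Measurable f₁ → Measurable f₂ →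
      (∀ U, MeasurableSet U → U ⊆ V₀ →
        ∫⁻ t in U, f₁ t ∂(P.map Y) ≤ ∫⁻ t in U, f₂ t ∂(P.map Y)) →
      ∀ᵐ ξ ∂P, Y ξ ∈ V₀ → f₁ (Y ξ) ≤ f₂ (Y ξ) := by
    intro f₁ f₂ hf₁ hf₂ hU
    refine ae_of_ae_map (p := fun t => t ∈ V₀ → f₁ t ≤ f₂ t) hY.aemeasurable
      ((ae_restrict_iff' hV₀).1 ?_)
    refine ae_le_of_forall_setLIntegral_le_of_sigmaFinite hf₁ fun s hs _ => ?_
    rw [Measure.restrict_restrict hs]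
    exact hU _ (hs.inter hV₀) inter_subset_right
  have e1 := hae ((γ.measurable_coe hA).const_mul (a : ℝ≥0∞)) hg.ennreal_ofReal fun U hU hUV => by
    rw [← hγint a A U hA hU, ← hgint U hU]
    exact ENNReal.ofReal_le_ofReal (h U hU hUV).1
  have e2 := hae hg.ennreal_ofReal ((γ.measurable_coe hC).const_mul (b : ℝ≥0∞)) fun U hU hUV => by
    rw [← hγint b C U hC hU, ← hgint U hU]
    exact ENNReal.ofReal_le_ofReal (h U hU hUV).2
  filter_upwards [e1, e2] with ξ h1 h2 hξ
  exact ⟨h1 hξ, h2 hξ⟩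

end Disintegration

section MeasurableOnWrt

variable {Ξ T : Type*} [MeasurableSpace T] {Ω : Set Ξ} {Y : Ξ → T} {g : Ξ → ℝ}

theorem MeasurableOnWrt.eq_of_eq (h : MeasurableOnWrt Ω Y g) {ξ ξ' : Ξ} (hξ : ξ ∈ Ω)
    (hξ' : ξ' ∈ Ω) (hY : Y ξ = Y ξ') : g ξ = g ξ' := by
  obtain ⟨f, -, hf⟩ := Measurable.exists_eq_measurable_comp h
  have h1 := congrFun hf ⟨ξ, hξ⟩
  have h2 := congrFun hf ⟨ξ', hξ'⟩
  simp only [Function.comp_apply] at h1 h2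
  rw [h1, h2, hY]

theorem MeasurableOnWrt.exists_measurable (h : MeasurableOnWrt Ω Y g) (h0 : ∀ ξ, 0 ≤ g ξ)
    (h1 : ∀ ξ, g ξ ≤ 1) : ∃ f : T → ℝ, Measurable f ∧ (∀ t, 0 ≤ f t) ∧ (∀ t, f t ≤ 1) ∧
      ∀ ξ ∈ Ω, g ξ = f (Y ξ) := by
  obtain ⟨f, hfm, hf⟩ := Measurable.exists_eq_measurable_comp h
  -- The factor is determined only on the image of `Ω`; truncation puts its other values into the
  -- unit interval.
  refine ⟨fun t => max 0 (min 1 (f t)), measurable_const.max (measurable_const.min hfm),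
    fun t => le_max_left _ _, fun t => max_le zero_le_one (min_le_left _ _), fun ξ hξ => ?_⟩
  have h2 : g ξ = f (Y ξ) := congrFun hf ⟨ξ, hξ⟩
  simp only
  rw [← h2, min_eq_right (h1 ξ), max_eq_right (h0 ξ)]

end MeasurableOnWrt

theorem EventWrt.exists_measurableSet {Ξ T : Type*} [MeasurableSpace T] {Y : Ξ → T} {Ω : Set Ξ}
    (h : EventWrt Y Ω) : ∃ V, MeasurableSet V ∧ Y ⁻¹' V = Ω := h

theorem EventWrt.measurableSet {Ξ T : Type*} [MeasurableSpace Ξ] [MeasurableSpace T] {Y : Ξ → T}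
    {Ω : Set Ξ} (h : EventWrt Y Ω) (hY : Measurable Y) : MeasurableSet Ω := by
  obtain ⟨V, hV, rfl⟩ := h.exists_measurableSet
  exact hY hV

theorem measurableSet_of_mem_finiteUnions_outBasis {d : ℕ} {c : EuclideanSpace ℝ (Fin d)}
    {D : Set (EuclideanSpace ℝ (Fin d))} {B : Set (OutConfig D)}
    (hB : B ∈ finiteUnions (outBasis D c)) : MeasurableSet B := by
  obtain ⟨F, hF, -, hFb, rfl⟩ := hB
  exact MeasurableSet.sUnion hF.countable fun B hB => measurableSet_of_mem_outBasis (hFb hB)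

theorem ProbabilityMeasure.eq_of_forall_measurableSet {α : Type*} [MeasurableSpace α]
    {μ ν : ProbabilityMeasure α} (h : ∀ A, MeasurableSet A → (μ A : ℝ) = ν A) : μ = ν := by
  apply Subtype.ext
  refine Measure.ext fun A hA => ?_
  change (μ : Measure α) A = (ν : Measure α) A
  rw [← ProbabilityMeasure.ennreal_coeFn_eq_coeFn_toMeasure,
    ← ProbabilityMeasure.ennreal_coeFn_eq_coeFn_toMeasure]
  exact_mod_cast h A hA

theorem ProbabilityMeasure.ofReal_coeFn {α : Type*} [MeasurableSpace α]
    (μ : ProbabilityMeasure α) (A : Set α) : ENNReal.ofReal (μ A : ℝ) = (μ : Measure α) A := by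
  rw [ENNReal.ofReal_coe_nnreal, ProbabilityMeasure.ennreal_coeFn_eq_coeFn_toMeasure]

/-! ### The bounds on each exhausting event, and their assembly. -/

section Main

variable {d : ℕ} {c : EuclideanSpace ℝ (Fin d)} {R : ℝ} {Ξ : Type*} [MeasurableSpace Ξ]
  {P : Measure Ξ} [IsProbabilityMeasure P]

/-- The two-sided bound on one of the exhausting events. -/
theorem ae_bounds_on_event (hR : 0 < R)
    {X : Ξ → Config (EuclideanSpace ℝ (Fin d))} {Xn : ℕ → Ξ → Config (EuclideanSpace ℝ (Fin d))}
    (hX : Measurable X) (hXn : ∀ n, Measurable (Xn n))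
    (hlim : ∀ᵐ ξ ∂P, Tendsto (fun n => Xn n ξ) atTop (𝓝 (X ξ)))
    (hgen : ∀ᵐ ξ ∂P, IsGeneric c R (X ξ).points)
    {ζ : Ξ → VarVec (Metric.ball c R)} {ζn : ℕ → Ξ → VarVec (Metric.ball c R)}
    (hζ : IsUniformOrdering P (Metric.ball c R) X ζ)
    (hζn : ∀ n, IsUniformOrdering P (Metric.ball c R) (Xn n) (ζn n))
    {ρ : Kernel (OutConfig (Metric.ball c R)) (VarVec (Metric.ball c R))}
    (hρ : IsRegularCondDistrib P (fun ξ => (X ξ).out (Metric.ball c R)) ζ ρ) {m : ℕ}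
    {ν : Ξ → ProbabilityMeasure (Fin m → Metric.ball c R)}
    (hν : ∀ A : Set (Fin m → Metric.ball c R), MeasurableSet A →
      MeasurableOnWrt (countEvent (Metric.ball c R) X m)
        (fun ξ => (X ξ).out (Metric.ball c R)) (fun ξ => (ν ξ A : ℝ)))
    {Ω : Set Ξ} {Ωn : ℕ → Set Ξ}
    (hΩ : EventWrt (fun ξ => (X ξ).out (Metric.ball c R)) Ω)
    (hΩm : Ω ⊆ countEvent (Metric.ball c R) X m)
    (hΩn : ∀ k, EventWrt (fun ξ => (Xn k ξ).out (Metric.ball c R)) (Ωn k))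
    (hliminf : Ω ⊆ liminf Ωn atTop)
    (hcomp : ∃ k₁ k₂ : ℝ, 0 < k₁ ∧ 0 < k₂ ∧
      ∀ A ∈ finiteUnions (inBasis (Metric.ball c R) m),
      ∀ B ∈ finiteUnions (outBasis (Metric.ball c R) c),
        ∃ ϑ : ℕ → ℝ, Tendsto ϑ atTop (𝓝 0) ∧ ∀ k,
          k₁ * P.real ({ξ | ζn k ξ ∈ Sigma.mk m '' A} ∩
              {ξ | (Xn k ξ).out (Metric.ball c R) ∈ B} ∩ Ωn k) ≤
            (∫ ξ in {ξ | (Xn k ξ).out (Metric.ball c R) ∈ B} ∩ Ωn k ∩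
              countEvent (Metric.ball c R) X m, (ν ξ A : ℝ) ∂P) + ϑ k ∧
          (∫ ξ in {ξ | (Xn k ξ).out (Metric.ball c R) ∈ B} ∩ Ωn k ∩
              countEvent (Metric.ball c R) X m, (ν ξ A : ℝ) ∂P) + ϑ k ≤
            k₂ * P.real ({ξ | ζn k ξ ∈ Sigma.mk m '' A} ∩
              {ξ | (Xn k ξ).out (Metric.ball c R) ∈ B} ∩ Ωn k)) :
    ∃ a b : ℝ≥0, 0 < a ∧ 0 < b ∧ ∀ᵐ ξ ∂P, ξ ∈ Ω →
      ∀ A : Set (Fin m → Metric.ball c R), MeasurableSet A →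
        a * (ν ξ : Measure (Fin m → Metric.ball c R)) A ≤
          ρ ((X ξ).out (Metric.ball c R)) (Sigma.mk m '' A) ∧
        ρ ((X ξ).out (Metric.ball c R)) (Sigma.mk m '' A) ≤
          b * (ν ξ : Measure (Fin m → Metric.ball c R)) A := by
  have := hρ.isMarkov
  obtain ⟨k₁, k₂, hk₁, hk₂, hcomp⟩ := hcomp
  lift k₁ to ℝ≥0 using hk₁.le
  lift k₂ to ℝ≥0 using hk₂.le
  have hk₁' : 0 < k₁ := by exact_mod_cast hk₁
  have hk₂' : 0 < k₂ := by exact_mod_cast hk₂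
  have hDo : IsOpen (Metric.ball c R) := Metric.isOpen_ball
  have hout : Measurable (Config.out (Metric.ball c R)) := Config.measurable_out hDo
  have hY : Measurable fun ξ => (X ξ).out (Metric.ball c R) := hout.comp hX
  have hW : MeasurableSet (countEvent (Metric.ball c R) X m) :=
    ((Config.measurable_encard_inter_of_isOpen hDo Metric.isBounded_ball).comp hX)
      (t := {(m : ℕ∞)}) trivial
  have hΩnm : ∀ k, MeasurableSet (Ωn k) := fun k => (hΩn k).measurableSet (hout.comp (hXn k))
  obtain ⟨V, hV, rfl⟩ := hΩ.exists_measurableSet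
  have hA : ∀ A ∈ finiteUnions (inBasis (Metric.ball c R) m),
      ∀ᵐ ξ ∂P, (X ξ).out (Metric.ball c R) ∈ V →
        k₁ * ρ ((X ξ).out (Metric.ball c R)) (Sigma.mk m '' A) ≤
          (ν ξ : Measure (Fin m → Metric.ball c R)) A ∧
        (ν ξ : Measure (Fin m → Metric.ball c R)) A ≤
          k₂ * ρ ((X ξ).out (Metric.ball c R)) (Sigma.mk m '' closure A) := by
    intro A hA
    have hAo := isOpen_of_mem_finiteUnions hA
    obtain ⟨g, hg, hg0, hg1, hgν⟩ := (hν A hAo.measurableSet).exists_measurable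
      (fun ξ => (ν ξ A).coe_nonneg) fun ξ => by exact_mod_cast (ν ξ).apply_le_one A
    have hlimit : ∀ U, MeasurableSet U → U ⊆ V →
        k₁ * P.real ((fun ξ => (X ξ).out (Metric.ball c R)) ⁻¹' U ∩ ζ ⁻¹' (Sigma.mk m '' A)) ≤
          ∫ ξ in (fun ξ => (X ξ).out (Metric.ball c R)) ⁻¹' U,
            g ((X ξ).out (Metric.ball c R)) ∂P ∧
        ∫ ξ in (fun ξ => (X ξ).out (Metric.ball c R)) ⁻¹' U,
            g ((X ξ).out (Metric.ball c R)) ∂P ≤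
          k₂ * P.real ((fun ξ => (X ξ).out (Metric.ball c R)) ⁻¹' U ∩
            ζ ⁻¹' (Sigma.mk m '' closure A)) := by
      intro U hU hUV
      refine comparison_limit hR hX hXn hlim hgen hζ hζn hW hΩnm hU
        ((preimage_mono hUV).trans hΩm)
        (fun ξ hξ => mem_liminf_iff_eventually_mem.1 (hliminf (hUV hξ))) (hg.comp hY)
        (fun ξ => hg0 _) (fun ξ => hg1 _) hAo hk₁ hk₂ fun B hB => ?_
      obtain ⟨ϑ, hϑ, h⟩ := hcomp A hA B hB
      refine ⟨ϑ, hϑ, fun k => ?_⟩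
      have hm : MeasurableSet ({ξ | (Xn k ξ).out (Metric.ball c R) ∈ B} ∩ Ωn k ∩
          countEvent (Metric.ball c R) X m) :=
        (((hout.comp (hXn k)) (measurableSet_of_mem_finiteUnions_outBasis hB)).inter
          (hΩnm k)).inter hW
      have hk := h k
      rw [setIntegral_congr_fun hm fun ξ hξ => hgν ξ hξ.2] at hk
      exact hk
    filter_upwards [hρ.ae_bounds hY hV hg hg0 hg1 (Sigma.measurableSet_image_mk hAo.measurableSet)
      (Sigma.measurableSet_image_mk isClosed_closure.measurableSet) hlimit] with ξ h hξ
    have h' := h hξ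
    rwa [← hgν ξ (hΩm hξ), ProbabilityMeasure.ofReal_coeFn] at h'
  -- The comparison bounds `ν` by multiples of `ρ`; solving for `ρ` inverts the constants and
  -- exchanges their roles.
  refine ⟨k₂⁻¹, k₁⁻¹, inv_pos.2 hk₂', inv_pos.2 hk₁', ?_⟩
  filter_upwards [(ae_ball_iff (countable_finiteUnions countable_inBasis)).2 hA] with ξ h hξ A hAm
  have hemb := Sigma.measurableEmbedding_mk (α := fun k => Fin k → Metric.ball c R) m
  have hb := measure_bounds_of_finiteUnions hDo (ν ξ : Measure (Fin m → Metric.ball c R))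
    ((ρ ((X ξ).out (Metric.ball c R))).comap
      (Sigma.mk (β := fun k => Fin k → Metric.ball c R) m)) (a := k₁) (b := k₂)
    (fun A hA => by rw [hemb.comap_apply]; exact (h A hA hξ).1)
    (fun A hA => by rw [hemb.comap_apply]; exact (h A hA hξ).2) A
  rw [hemb.comap_apply] at hb
  rw [ENNReal.coe_inv hk₁'.ne', ENNReal.coe_inv hk₂'.ne']
  exact ⟨(ENNReal.inv_mul_le_iff (by exact_mod_cast hk₂'.ne') ENNReal.coe_ne_top).2 hb.2,
    (ENNReal.mul_le_iff_le_inv (by exact_mod_cast hk₁'.ne') ENNReal.coe_ne_top).1 hb.1⟩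

end Main

theorem theorem3p3 {d : ℕ}
    -- the open ball `D`
    (c : EuclideanSpace ℝ (Fin d)) (R : ℝ) (hR : 0 < R)
    (D : Set (EuclideanSpace ℝ (Fin d))) (hD : D = Metric.ball c R)
    {Ξ : Type*} [MeasurableSpace Ξ] (P : Measure Ξ) [IsProbabilityMeasure P]
    -- the point processes `X n → X`
    (X : Ξ → Config (EuclideanSpace ℝ (Fin d)))
    (Xn : ℕ → Ξ → Config (EuclideanSpace ℝ (Fin d)))
    (hX : Measurable X) (hXn : ∀ n, Measurable (Xn n))
    (hlim : ∀ᵐ ξ ∂P, Tendsto (fun n => Xn n ξ) atTop (𝓝 (X ξ)))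
    (hint : ∀ K : Set (EuclideanSpace ℝ (Fin d)), MeasurableSet K → volume K = 0 →
      firstIntensity P X K = 0)
    -- the inside points in uniform random order
    (ζ : Ξ → VarVec D) (ζn : ℕ → Ξ → VarVec D)
    (hζ : IsUniformOrdering P D X ζ) (hζn : ∀ n, IsUniformOrdering P D (Xn n) (ζn n))
    -- rigidity of the number of points
    (N : OutConfig D → ℕ) (hN : Measurable N)
    (hrigid : ∀ᵐ ξ ∂P, ((X ξ).points ∩ D).encard = N ((X ξ).out D))
    -- the conditional distribution of the inside points given the outside points
    (ρ : Kernel (OutConfig D) (VarVec D))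
    (hρ : IsRegularCondDistrib P (fun ξ => (X ξ).out D) ζ ρ)
    (m : ℕ) (hm : 0 < P (countEvent D X m))
    -- (a): only the values of `ν` on the event `countEvent D X m` matter
    (ν : Ξ → ProbabilityMeasure (Fin m → D))
    (hν : ∀ A : Set (Fin m → D), MeasurableSet A →
      MeasurableOnWrt (countEvent D X m) (fun ξ => (X ξ).out D) (fun ξ => (ν ξ A : ℝ)))
    -- (b): `nk j k` is the sequence `n_k` belonging to `j`, and `Ωn j k` is the event `Ω_{n_k}(j)`
    (Ω : ℕ → Set Ξ) (nk : ℕ → ℕ → ℕ) (Ωn : ℕ → ℕ → Set Ξ)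
    (hnk : ∀ j, Tendsto (nk j) atTop atTop)
    (hΩ : ∀ j, EventWrt (fun ξ => (X ξ).out D) (Ω j))
    (hexh : Exhausts P Ω (countEvent D X m))
    (hΩn : ∀ j k, EventWrt (fun ξ => (Xn (nk j k) ξ).out D) (Ωn j k))
    (hΩnm : ∀ j k, Ωn j k ⊆ countEvent D (Xn (nk j k)) m)
    (hliminf : ∀ j, Ω j ⊆ liminf (Ωn j) atTop)
    (hcomp : ∀ j, ∃ k₁ k₂ : ℝ, 0 < k₁ ∧ 0 < k₂ ∧
      ∀ A ∈ finiteUnions (inBasis D m), ∀ B ∈ finiteUnions (outBasis D c),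
        ∃ ϑ : ℕ → ℝ, Tendsto ϑ atTop (𝓝 0) ∧ ∀ k,
          k₁ * P.real ({ξ | ζn (nk j k) ξ ∈ Sigma.mk m '' A} ∩
              {ξ | (Xn (nk j k) ξ).out D ∈ B} ∩ Ωn j k) ≤
            (∫ ξ in {ξ | (Xn (nk j k) ξ).out D ∈ B} ∩ Ωn j k ∩ countEvent D X m,
              (ν ξ A : ℝ) ∂P) + ϑ k ∧
          (∫ ξ in {ξ | (Xn (nk j k) ξ).out D ∈ B} ∩ Ωn j k ∩ countEvent D X m,
              (ν ξ A : ℝ) ∂P) + ϑ k ≤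
            k₂ * P.real ({ξ | ζn (nk j k) ξ ∈ Sigma.mk m '' A} ∩
              {ξ | (Xn (nk j k) ξ).out D ∈ B} ∩ Ωn j k)) :
    -- the map `ν'` induced by `ν`, and the two-sided bound
    ∃ ν' : OutConfig D → ProbabilityMeasure (Fin m → D),
      (∀ ξ ∈ countEvent D X m, ν' ((X ξ).out D) = ν ξ) ∧
      ∃ lo up : OutConfig D → ℝ≥0, (∀ ω, 0 < lo ω) ∧ (∀ ω, 0 < up ω) ∧
        ∀ᵐ ξ ∂P, ξ ∈ countEvent D X m → ∀ A : Set (Fin m → D), MeasurableSet A →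
          (lo ((X ξ).out D) : ℝ≥0∞) * (ν' ((X ξ).out D) : Measure (Fin m → D)) A ≤
            ρ ((X ξ).out D) (Sigma.mk m '' A) ∧
          ρ ((X ξ).out D) (Sigma.mk m '' A) ≤
            (up ((X ξ).out D) : ℝ≥0∞) * (ν' ((X ξ).out D) : Measure (Fin m → D)) A := by
  subst hD
  have hΞ : Nonempty Ξ := by
    by_contra h
    rw [not_nonempty_iff] at h
    simp [Set.eq_empty_of_isEmpty] at hm
  have hgen := ae_isGeneric hX hint c hR
  have hΩm : ∀ j, Ω j ⊆ countEvent (Metric.ball c R) X m := fun j => by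
    cases j with
    | zero => exact hexh.2.1
    | succ j => exact (hexh.1 j).2
  have hj : ∀ j, ∃ a b : ℝ≥0, 0 < a ∧ 0 < b ∧ ∀ᵐ ξ ∂P, ξ ∈ Ω j →
      ∀ A : Set (Fin m → Metric.ball c R), MeasurableSet A →
        a * (ν ξ : Measure (Fin m → Metric.ball c R)) A ≤
          ρ ((X ξ).out (Metric.ball c R)) (Sigma.mk m '' A) ∧
        ρ ((X ξ).out (Metric.ball c R)) (Sigma.mk m '' A) ≤
          b * (ν ξ : Measure (Fin m → Metric.ball c R)) A := fun j =>
    ae_bounds_on_event hR hX (fun k => hXn (nk j k))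
      (hlim.mono fun ξ h => h.comp (hnk j)) hgen hζ (fun k => hζn (nk j k)) hρ hν (hΩ j) (hΩm j)
      (hΩn j) (hliminf j) (hcomp j)
  choose a b ha hb hab using hj
  choose V _ hVΩ using fun j => (hΩ j).exists_measurableSet
  classical
  -- Any preimage in the event may be chosen: by the measurability in (a), `ν` depends there only on
  -- the outside configuration. The value elsewhere is arbitrary.
  let ν' : OutConfig (Metric.ball c R) → ProbabilityMeasure (Fin m → Metric.ball c R) := fun ω =>
    if h : ∃ ξ ∈ countEvent (Metric.ball c R) X m, (X ξ).out (Metric.ball c R) = ω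
      then ν h.choose else ν (Classical.arbitrary Ξ)
  have hν' : ∀ ξ ∈ countEvent (Metric.ball c R) X m,
      ν' ((X ξ).out (Metric.ball c R)) = ν ξ := by
    intro ξ hξ
    have h : ∃ ξ' ∈ countEvent (Metric.ball c R) X m,
        (X ξ').out (Metric.ball c R) = (X ξ).out (Metric.ball c R) := ⟨ξ, hξ, rfl⟩
    simp only [ν', dif_pos h]
    exact ProbabilityMeasure.eq_of_forall_measurableSet fun A hA =>
      (hν A hA).eq_of_eq h.choose_spec.1 hξ h.choose_spec.2
  have hnull : P (countEvent (Metric.ball c R) X m \ ⋃ j, Ω j) = 0 :=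
    le_antisymm (ge_of_tendsto' hexh.2.2 fun j =>
      measure_mono (sdiff_subset_sdiff_right (subset_iUnion Ω j))) zero_le
  -- The constants of the first `j` with `ω ∈ V j` are used. The default 1 only secures positivity,
  -- since the sets `Ω j` cover the event up to a null set.
  refine ⟨ν', hν', fun ω => if h : ∃ j, ω ∈ V j then a (Nat.find h) else 1,
    fun ω => if h : ∃ j, ω ∈ V j then b (Nat.find h) else 1, fun ω => ?_, fun ω => ?_, ?_⟩
  · dsimp only
    split_ifs
    · exact ha _
    · exact one_pos
  · dsimp only
    split_ifs
    · exact hb _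
    · exact one_pos
  · filter_upwards [ae_all_iff.2 hab, measure_eq_zero_iff_ae_notMem.1 hnull] with ξ h1 h2 hξ A hA
    have hmem : ∃ j, (X ξ).out (Metric.ball c R) ∈ V j := by
      by_contra hcon
      refine h2 ⟨hξ, fun h => hcon ?_⟩
      obtain ⟨j, hj⟩ := mem_iUnion.1 h
      rw [← hVΩ j] at hj
      exact ⟨j, hj⟩
    have hΩfind : ξ ∈ Ω (Nat.find hmem) := by
      rw [← hVΩ]
      exact Nat.find_spec hmem
    rw [hν' ξ hξ]
    simp only [dif_pos hmem]
    exact h1 _ hΩfind A hA
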